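/- Consider two unit regular hexagons (side length $1$) in the Euclidean plane that share a side: the left one centred at $(0,0)$ and the right one at $(\sqrt3,0)$, both with two vertical sides, the common side joining $(\tfrac{\sqrt3}{2},-\tfrac12)$ and $(\tfrac{\sqrt3}{2},\tfrac12)$. Decompose each hexagon into three unit rhombuses (side length $1$, acute angle $\pi/3$) by joining its centre to its vertices in the directions $30^\circ$, $150^\circ$ and $270^\circ$. Let $H$ be the interior of the lower left rhombus of the left hexagon, with corners $(0,0)$, $(-\tfrac{\sqrt3}{2},\tfrac12)$, $(-\tfrac{\sqrt3}{2},-\tfrac12)$, $(0,-1)$, and let $E$ be the interior of the lower right rhombus of the right hexagon, with corners $(\sqrt3,0)$, $(\sqrt3,-1)$, $(\tfrac{3\sqrt3}{2},-\tfrac12)$, $(\tfrac{3\sqrt3}{2},\tfrac12)$. Let $\varphi$ be any isometry of the plane, and let $X$ and $Y$ be independent random points, $X$ uniformly distributed in $\varphi(H)$ and $Y$ uniformly distributed in $\varphi(E)$. Then the distribution of the distance $|X-Y|$ is absolutely continuous, with the non-negative probability density function $f_{D_7}$ given by $f_{D_7}(d)=2d\,g(d)$, where - for $\sqrt3\le d\le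 2$, $$g(d)=\tfrac{2}{\sqrt3}\left(\tfrac{2d^2}{3}+1\right)\sin^{-1}\tfrac{\sqrt3}{2d}+\tfrac{4}{\sqrt3}\sin^{-1}\tfrac{\sqrt3}{d}-\left(\tfrac13+\tfrac{2\pi}{9\sqrt3}\right)d^2+\sqrt{4d^2-3}+\tfrac43\sqrt{d^2-3}-\tfrac{7\pi}{3\sqrt3}-2;$$ - for $2\le d\le \tfrac{3\sqrt3}{2}$, $$g(d)=\tfrac{2}{\sqrt3}\left(\tfrac{2d^2}{3}+1\right)\sin^{-1}\tfrac{\sqrt3}{2d}-\tfrac{2}{\sqrt3}\left(\tfrac{d^2}{3}+2\right)\sin^{-1}\tfrac{\sqrt3}{d}+\sqrt{4d^2-3}-2\sqrt{d^2-3}+\tfrac{\pi}{3\sqrt3};$$ - for $\tfrac{3\sqrt3}{2}\le d\le\sqrt7$, $$g(d)=\tfrac{2}{\sqrt3}\left(\tfrac{2d^2}{3}+1\right)\sin^{-1}\tfrac{\sqrt3}{2d}-\tfrac{2}{\sqrt3}\left(\tfrac{d^2}{3}+2\right)\sin^{-1}\tfrac{\sqrt3}{d}-2\sqrt3\,\sin^{-1}\tfrac{3\sqrt3}{2d}+\sqrt{4d^2-3}-2\sqrt{d^2-3}-\tfrac23\sqrt{4d^2-27}+\tfrac{10\pi}{3\sqrt3};$$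 - for $\sqrt7\le d\le 3$, $$g(d)=\tfrac{1}{\sqrt3}\left(\tfrac{2d^2}{3}+1\right)\sin^{-1}\tfrac{\sqrt3}{2d}-\tfrac{4}{\sqrt3}\left(\tfrac{d^2}{3}+2\right)\sin^{-1}\tfrac{\sqrt3}{d}-3\sqrt3\,\sin^{-1}\tfrac{3\sqrt3}{2d}+\left(\tfrac13+\tfrac{2\pi}{9\sqrt3}\right)d^2+\tfrac12\sqrt{4d^2-3}-4\sqrt{d^2-3}-\sqrt{4d^2-27}+\tfrac{17\pi}{3\sqrt3}+\tfrac92;$$ - for $3\le d\le 2\sqrt3$, $$g(d)=\tfrac{1}{\sqrt3}\left(\tfrac{2d^2}{3}+1\right)\sin^{-1}\tfrac{\sqrt3}{2d}-\tfrac{4}{\sqrt3}\left(\tfrac{d^2}{3}+2\right)\sin^{-1}\tfrac{\sqrt3}{d}+\left(\tfrac{2d^2}{3\sqrt3}+3\sqrt3\right)\sin^{-1}\tfrac{3\sqrt3}{2d}+\tfrac12\sqrt{4d^2-3}-4\sqrt{d^2-3}+\tfrac32\sqrt{4d^2-27}-\tfrac{\pi}{3\sqrt3};$$ - for $2\sqrt3\le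 d\le\sqrt{13}$, $$g(d)=\tfrac{1}{\sqrt3}\left(\tfrac{2d^2}{3}+1\right)\sin^{-1}\tfrac{\sqrt3}{2d}+\left(\tfrac{2d^2}{3\sqrt3}+3\sqrt3\right)\sin^{-1}\tfrac{3\sqrt3}{2d}+\tfrac{8}{\sqrt3}\sin^{-1}\tfrac{2\sqrt3}{d}-\left(\tfrac13+\tfrac{2\pi}{9\sqrt3}\right)d^2+\tfrac12\sqrt{4d^2-3}+\tfrac32\sqrt{4d^2-27}+\tfrac43\sqrt{d^2-12}-\tfrac{17\pi}{3\sqrt3}-8;$$ and $f_{D_7}(d)=0$ for all other $d$. The six formulas agree at the common endpoints of their intervals, so that $f_{D_7}$ is well defined. -/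

import Mathlib

open MeasureTheory ProbabilityTheory

noncomputable section

/-- The Euclidean plane. -/
abbrev Plane : Type := EuclideanSpace ℝ (Fin 2)

/-- The vertices, counterclockwise, of the regular hexagon of side length `1` centred at the
origin, in the position in which two of its sides are vertical: `hexVertex 0` and `hexVertex 5`
are the endpoints of its right side, `hexVertex 2` and `hexVertex 3` those of its left side. -/
def hexVertex (k : ℕ) : Plane :=
  !₂[Real.cos ((2 * k + 1) * Real.pi / 6), Real.sin ((2 * k + 1) * Real.pi / 6)]

/-- The interior of the rhombus with corners `c`, `c + hexVertex k`, `c + hexVertex (k + 1)`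
and `c + hexVertex (k + 2)`: side length `1` and acute angle `π / 3`. For `k = 0, 2, 4` these
three rhombuses decompose the unit hexagon with centre `c` (up to their sides). -/
def hexRhombus (c : Plane) (k : ℕ) : Set Plane :=
  {x | ∃ s ∈ Set.Ioo (0 : ℝ) 1, ∃ t ∈ Set.Ioo (0 : ℝ) 1,
    x = c + s • hexVertex k + t • hexVertex (k + 2)}

/-- The centre of the right one of two adjacent unit hexagons, the left one being centred at the
origin; they share the side from `(√3 / 2, -1 / 2)` to `(√3 / 2, 1 / 2)`. -/
def rightCentre : Plane := !₂[√3, 0]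

/-- Rhombus `H`: the lower left one of the three rhombuses of the left hexagon, with corners
`(0, 0)`, `(-√3 / 2, 1 / 2)`, `(-√3 / 2, -1 / 2)`, `(0, -1)`. -/
def rhombusH : Set Plane := hexRhombus 0 2

/-- Rhombus `E`: the lower right one of the three rhombuses of the right hexagon, with corners
`(√3, 0)`, `(√3, -1)`, `(3√3 / 2, -1 / 2)`, `(3√3 / 2, 1 / 2)`. -/
def rhombusE : Set Plane := hexRhombus rightCentre 4

/-- The formula on `√3 ≤ d ≤ 2`. -/
def hePiece1 (d : ℝ) : ℝ :=
  2 * d * (2 / √3 * (2 * d ^ 2 / 3 + 1) * Real.arcsin (√3 / (2 * d))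
    + 4 / √3 * Real.arcsin (√3 / d)
    - (1 / 3 + 2 * Real.pi / (9 * √3)) * d ^ 2
    + √(4 * d ^ 2 - 3) + 4 / 3 * √(d ^ 2 - 3) - 7 * Real.pi / (3 * √3) - 2)

/-- The formula on `2 ≤ d ≤ 3√3 / 2`. -/
def hePiece2 (d : ℝ) : ℝ :=
  2 * d * (2 / √3 * (2 * d ^ 2 / 3 + 1) * Real.arcsin (√3 / (2 * d))
    - 2 / √3 * (d ^ 2 / 3 + 2) * Real.arcsin (√3 / d)
    + √(4 * d ^ 2 - 3) - 2 * √(d ^ 2 - 3) + Real.pi / (3 * √3))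

/-- The formula on `3√3 / 2 ≤ d ≤ √7`. -/
def hePiece3 (d : ℝ) : ℝ :=
  2 * d * (2 / √3 * (2 * d ^ 2 / 3 + 1) * Real.arcsin (√3 / (2 * d))
    - 2 / √3 * (d ^ 2 / 3 + 2) * Real.arcsin (√3 / d)
    - 2 * √3 * Real.arcsin (3 * √3 / (2 * d))
    + √(4 * d ^ 2 - 3) - 2 * √(d ^ 2 - 3) - 2 / 3 * √(4 * d ^ 2 - 27)
    + 10 * Real.pi / (3 * √3))

/-- The formula on `√7 ≤ d ≤ 3`. -/
def hePiece4 (d : ℝ) : ℝ :=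
  2 * d * (1 / √3 * (2 * d ^ 2 / 3 + 1) * Real.arcsin (√3 / (2 * d))
    - 4 / √3 * (d ^ 2 / 3 + 2) * Real.arcsin (√3 / d)
    - 3 * √3 * Real.arcsin (3 * √3 / (2 * d))
    + (1 / 3 + 2 * Real.pi / (9 * √3)) * d ^ 2 + √(4 * d ^ 2 - 3) / 2
    - 4 * √(d ^ 2 - 3) - √(4 * d ^ 2 - 27)
    + 17 * Real.pi / (3 * √3) + 9 / 2)

/-- The formula on `3 ≤ d ≤ 2√3`. -/
def hePiece5 (d : ℝ) : ℝ :=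
  2 * d * (1 / √3 * (2 * d ^ 2 / 3 + 1) * Real.arcsin (√3 / (2 * d))
    - 4 / √3 * (d ^ 2 / 3 + 2) * Real.arcsin (√3 / d)
    + (2 * d ^ 2 / (3 * √3) + 3 * √3) * Real.arcsin (3 * √3 / (2 * d))
    + √(4 * d ^ 2 - 3) / 2 - 4 * √(d ^ 2 - 3)
    + 3 / 2 * √(4 * d ^ 2 - 27) - Real.pi / (3 * √3))

/-- The formula on `2√3 ≤ d ≤ √13`. -/
def hePiece6 (d : ℝ) : ℝ :=
  2 * d * (1 / √3 * (2 * d ^ 2 / 3 + 1) * Real.arcsin (√3 / (2 * d))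
    + (2 * d ^ 2 / (3 * √3) + 3 * √3) * Real.arcsin (3 * √3 / (2 * d))
    + 8 / √3 * Real.arcsin (2 * √3 / d)
    - (1 / 3 + 2 * Real.pi / (9 * √3)) * d ^ 2 + √(4 * d ^ 2 - 3) / 2
    + 3 / 2 * √(4 * d ^ 2 - 27) + 4 / 3 * √(d ^ 2 - 12)
    - 17 * Real.pi / (3 * √3) - 8)

/-- The density of `|HE|`. At a common endpoint of two neighbouring intervals the code takes the
left one of the two formulas. -/
def heDensity (d : ℝ) : ℝ :=
  if d < √3 then 0
  else if d ≤ 2 then hePiece1 d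
  else if d ≤ 3 * √3 / 2 then hePiece2 d
  else if d ≤ √7 then hePiece3 d
  else if d ≤ 3 then hePiece4 d
  else if d ≤ 2 * √3 then hePiece5 d
  else if d ≤ √13 then hePiece6 d
  else 0

end

/-! Let v₂, v₄, v₆ be the edge vectors and c the right centre. Up to the isometry, which changes no
distance, X = s v₂ + t v₄ and Y = c + t' v₄ + s' v₆ with independent uniform parameters on the unit
interval. Then Y − X = (√3/2 · a, a/2 − b), where a = 2 + s + s' and b = 1 + s + t' − t, so |X − Y|²
= a² − ab + b².

Given s, the difference t' − t has the triangular density, and s ranges over an interval determined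
by a. Hence (a, b) has as density a difference of two values of the triangular distribution function
(`obliqueDensity`). In polar coordinates with ρ = 2r/√3, one has a = ρ cos θ, b = ρ cos(θ + π/3) and
a − b = ρ cos(θ − π/3). With the Jacobian 2/√3 the density of the distance at r is ρ ·
`angularIntegral ρ`.

The density of (a, b) is invariant under b ↔ a − b, that is θ ↔ −θ, and changes its form only at a =
2, 3, 4, that is at θ = arccos(j/ρ). Since the triangular distribution function is a combination of
squared positive parts, everything reduces to integrals of (ρ cos φ − k)₊² from 0 to arccos(j/ρ) ±
π/3. Such an integral is elementary: either the positive part is active throughout, or the angle has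
passed ±arccos(k/ρ) and only the full half cap remains.

The case changes exactly when the line a = j meets b = k or a − b = k on the circle, at ρ² = j² +
(2k − j)²/3. Together with ρ = j, where the circle reaches the line a = j, and with r² = 3ρ²/4, this
gives r² = 3, 4, 27/4, 7, 9, 12, 13, the endpoints of the six formulas. Continuity and
non-negativity come for free, because all formulas evaluate one integral of a non-negative function.
-/

/-! ### Integrals of squared positive parts over an arc. -/

/-- The integral of the squared positive part of `ρ cos φ - k` over the angles from `0` to `β`. -/
noncomputable def capIntegral (ρ k β : ℝ) : ℝ :=
  ∫ φ in (0 : ℝ)..β, (max 0 (ρ * Real.cos φ - k)) ^ 2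

/-- The primitive of `(ρ cos φ - k) ^ 2` that vanishes at `0`. -/
noncomputable def capPrimitive (ρ k β : ℝ) : ℝ :=
  ρ ^ 2 * (β + Real.sin β * Real.cos β) / 2 - 2 * ρ * k * Real.sin β + k ^ 2 * β

theorem continuous_capIntegrand (ρ k : ℝ) :
    Continuous fun φ : ℝ => (max 0 (ρ * Real.cos φ - k)) ^ 2 := by
  fun_prop

theorem hasDerivAt_capIntegral (ρ k β : ℝ) :
    HasDerivAt (capIntegral ρ k) ((max 0 (ρ * Real.cos β - k)) ^ 2) β :=
  intervalIntegral.integral_hasDerivAt_right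
    ((continuous_capIntegrand ρ k).intervalIntegrable _ _)
    ((continuous_capIntegrand ρ k).stronglyMeasurableAtFilter _ _)
    (continuous_capIntegrand ρ k).continuousAt

theorem hasDerivAt_capPrimitive (ρ k β : ℝ) :
    HasDerivAt (capPrimitive ρ k) ((ρ * Real.cos β - k) ^ 2) β := by
  have hs := Real.hasDerivAt_sin β
  have hc := Real.hasDerivAt_cos β
  have h := (((((hasDerivAt_id β).add (hs.mul hc)).const_mul (ρ ^ 2)).div_const 2).sub
    (hs.const_mul (2 * ρ * k))).add ((hasDerivAt_id β).const_mul (k ^ 2))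
  refine h.congr_deriv ?_
  have := Real.sin_sq_add_cos_sq β
  linear_combination (- ρ ^ 2 / 2) * this

theorem capIntegral_neg (ρ k β : ℝ) : capIntegral ρ k (-β) = -capIntegral ρ k β := by
  unfold capIntegral
  have h := intervalIntegral.integral_comp_neg (a := 0) (b := β)
    (fun φ : ℝ => (max 0 (ρ * Real.cos φ - k)) ^ 2)
  simp only [Real.cos_neg, neg_zero] at h
  rw [h, intervalIntegral.integral_symm]

theorem capPrimitive_zero (ρ k : ℝ) : capPrimitive ρ k 0 = 0 := by simp [capPrimitive]

theorem capPrimitive_neg (ρ k β : ℝ) : capPrimitive ρ k (-β) = -capPrimitive ρ k β := by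
  simp only [capPrimitive, Real.sin_neg, Real.cos_neg]; ring

/-- Cosine decreases on [0, π], so non-negativity of ρ cos φ − k at the endpoint gives it on the
whole arc, and the positive part can be dropped. -/
theorem capIntegral_eq_capPrimitive_of_nonneg {ρ k β : ℝ} (hρ : 0 ≤ ρ) (hβ : 0 ≤ β)
    (hβπ : β ≤ Real.pi) (h : k ≤ ρ * Real.cos β) : capIntegral ρ k β = capPrimitive ρ k β := by
  have := intervalIntegral.integral_eq_sub_of_hasDerivAt_of_le hβ
    (f := capPrimitive ρ k) (f' := fun φ : ℝ => (max 0 (ρ * Real.cos φ - k)) ^ 2)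
    (fun φ _ => (hasDerivAt_capPrimitive ρ k φ).continuousAt.continuousWithinAt)
    (fun φ hφ => by
      have hcos : Real.cos β ≤ Real.cos φ :=
        Real.cos_le_cos_of_nonneg_of_le_pi hφ.1.le hβπ hφ.2.le
      have := mul_le_mul_of_nonneg_left hcos hρ
      rw [max_eq_right (by linarith)]
      exact hasDerivAt_capPrimitive ρ k φ)
    ((continuous_capIntegrand ρ k).intervalIntegrable _ _)
  rw [capIntegral, this, capPrimitive_zero, sub_zero]

theorem capIntegral_eq_capPrimitive {ρ k β : ℝ} (hρ : 0 ≤ ρ) (hβ : |β| ≤ Real.pi)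
    (h : k ≤ ρ * Real.cos β) : capIntegral ρ k β = capPrimitive ρ k β := by
  rcases le_total 0 β with h0 | h0
  · exact capIntegral_eq_capPrimitive_of_nonneg hρ h0 ((le_abs_self β).trans hβ) h
  · have := capIntegral_eq_capPrimitive_of_nonneg (β := -β) hρ (by linarith)
      (k := k) ((neg_le_abs β).trans hβ) (by rwa [Real.cos_neg])
    rw [capIntegral_neg, capPrimitive_neg] at this
    linarith

theorem arccos_le_of_cos_le {x θ : ℝ} (h0 : 0 ≤ θ) (hπ : θ ≤ Real.pi) (h : Real.cos θ ≤ x) :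
    Real.arccos x ≤ θ := by
  have := Real.antitone_arccos h
  rwa [Real.arccos_cos h0 hπ] at this

theorem le_arccos_of_le_cos {x θ : ℝ} (h0 : 0 ≤ θ) (hπ : θ ≤ Real.pi) (h : x ≤ Real.cos θ) :
    θ ≤ Real.arccos x := by
  have := Real.antitone_arccos h
  rwa [Real.arccos_cos h0 hπ] at this

/-- Past the angle where ρ cos φ = k the integrand vanishes, so the integral no longer depends on
the endpoint. -/
theorem capIntegral_eq_capPrimitive_arccos {ρ k β : ℝ} (hρ : 0 < ρ) (hk : 0 ≤ k) (hβ : 0 ≤ β)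
    (hβπ : β ≤ Real.pi) (h : ρ * Real.cos β ≤ k) :
    capIntegral ρ k β = capPrimitive ρ k (Real.arccos (k / ρ)) := by
  set α := Real.arccos (k / ρ) with hα
  have hα0 : 0 ≤ α := Real.arccos_nonneg _
  have hαπ : α ≤ Real.pi := Real.arccos_le_pi _
  have hαβ : α ≤ β := arccos_le_of_cos_le hβ hβπ (by rw [le_div_iff₀ hρ]; linarith)
  have hsplit : capIntegral ρ k β = capIntegral ρ k α +
      ∫ φ in α..β, (max 0 (ρ * Real.cos φ - k)) ^ 2 :=
    (intervalIntegral.integral_add_adjacent_intervals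
      ((continuous_capIntegrand ρ k).intervalIntegrable _ _)
      ((continuous_capIntegrand ρ k).intervalIntegrable _ _)).symm
  have hzero : ∫ φ in α..β, (max 0 (ρ * Real.cos φ - k)) ^ 2 = 0 := by
    have := intervalIntegral.integral_eq_sub_of_hasDerivAt_of_le hαβ
      (f := fun _ => (0 : ℝ)) (f' := fun φ : ℝ => (max 0 (ρ * Real.cos φ - k)) ^ 2)
      continuousOn_const
      (fun φ hφ => by
        have hlt : Real.cos φ ≤ k / ρ := by
          by_contra hcon
          have := le_arccos_of_le_cos (hα0.trans hφ.1.le) (hφ.2.le.trans hβπ)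
            (not_le.mp hcon).le
          linarith [hφ.1]
        rw [le_div_iff₀ hρ] at hlt
        rw [max_eq_left (by linarith)]
        simpa using hasDerivAt_const φ (0 : ℝ))
      ((continuous_capIntegrand ρ k).intervalIntegrable _ _)
    simpa using this
  rw [hsplit, hzero, add_zero]
  rcases le_total k ρ with hkρ | hkρ
  · refine capIntegral_eq_capPrimitive_of_nonneg hρ.le hα0 hαπ ?_
    rw [hα, Real.cos_arccos (by linarith [div_nonneg hk hρ.le]) ((div_le_one hρ).mpr hkρ),
      mul_div_cancel₀ _ hρ.ne']
  -- For k ≥ ρ the integrand is zero on the arc, and `Real.arccos` is clamped to 0, so the same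
  -- formula still holds.
  · have : α = 0 := Real.arccos_eq_zero.mpr ((one_le_div hρ).mpr hkρ)
    rw [this, capPrimitive_zero]; simp [capIntegral]

/-! ### The triangular distribution and the density of the oblique coordinates. -/

/-- The distribution function of the difference of two independent uniform variables on the unit
interval. -/
noncomputable def triCdf (u : ℝ) : ℝ :=
  ((max 0 (u + 1)) ^ 2 - 2 * (max 0 u) ^ 2 + (max 0 (u - 1)) ^ 2) / 2

@[fun_prop]
theorem continuous_triCdf : Continuous triCdf := by unfold triCdf; fun_prop

theorem max_zero_neg_sq (v : ℝ) : (max 0 (-v)) ^ 2 = v ^ 2 - (max 0 v) ^ 2 := by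
  rcases le_total 0 v with h | h
  · rw [max_eq_left (neg_nonpos.mpr h), max_eq_right h]; ring
  · rw [max_eq_right (neg_nonneg.mpr h), max_eq_left h]; ring

theorem triCdf_neg (u : ℝ) : triCdf (-u) = 1 - triCdf u := by
  unfold triCdf
  rw [show -u + 1 = -(u - 1) by ring, show -u - 1 = -(u + 1) by ring, max_zero_neg_sq,
    max_zero_neg_sq, max_zero_neg_sq]
  ring

/-- Only the point 0 needs an argument: there the function is bounded by v², which is o(v). -/
theorem hasDerivAt_max_zero_sq (u : ℝ) :
    HasDerivAt (fun v : ℝ => (max 0 v) ^ 2) (2 * max 0 u) u := by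
  rcases lt_trichotomy u 0 with h | h | h
  · rw [max_eq_left h.le, mul_zero]
    refine (hasDerivAt_const u (0 : ℝ)).congr_of_eventuallyEq ?_
    filter_upwards [gt_mem_nhds h] with v hv
    rw [max_eq_left hv.le]; simp
  · subst h
    simp only [max_self, mul_zero]
    rw [hasDerivAt_iff_isLittleO]
    simp only [max_self, sub_zero, smul_zero]
    refine Asymptotics.IsBigO.trans_isLittleO (g := fun v : ℝ => v ^ 2) ?_ ?_
    · refine Asymptotics.isBigO_of_le _ fun v => ?_
      simp only [norm_pow, ne_eq, OfNat.ofNat_ne_zero, not_false_eq_true, zero_pow, sub_zero]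
      gcongr
      rw [Real.norm_eq_abs, Real.norm_eq_abs, abs_of_nonneg (le_max_left _ _)]
      exact max_le (abs_nonneg v) (le_abs_self v)
    · exact Asymptotics.isLittleO_pow_id one_lt_two
  · rw [max_eq_right h.le]
    have : HasDerivAt (fun v : ℝ => v ^ 2) (2 * u) u := by simpa using hasDerivAt_pow 2 u
    refine this.congr_of_eventuallyEq ?_
    filter_upwards [lt_mem_nhds h] with v hv
    rw [max_eq_right hv.le]

theorem hasDerivAt_triCdf (u : ℝ) : HasDerivAt triCdf (max 0 (1 - |u|)) u := by
  have h1 := (hasDerivAt_max_zero_sq (u + 1)).comp u ((hasDerivAt_id u).add_const (1 : ℝ))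
  have h2 := (hasDerivAt_max_zero_sq u).const_mul (2 : ℝ)
  have h3 := (hasDerivAt_max_zero_sq (u - 1)).comp u ((hasDerivAt_id u).sub_const (1 : ℝ))
  refine (((h1.sub h2).add h3).div_const 2).congr_deriv ?_
  rcases le_total 0 u with h | h
  · rw [abs_of_nonneg h]
    simp only [max_def]; split_ifs <;> linarith
  · rw [abs_of_nonpos h]
    simp only [max_def]; split_ifs <;> linarith

/-- The density of `(2 + s + s', 1 + s + t' - t)` for independent uniform variables `s`, `t`,
`s'`, `t'` on the unit interval. -/
noncomputable def obliqueDensity (a b : ℝ) : ℝ :=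
  triCdf (b - 1 - max 0 (a - 3)) - triCdf (b - 1 - max (max 0 (a - 3)) (min 1 (a - 2)))

theorem continuous_obliqueDensity :
    Continuous fun p : ℝ × ℝ => obliqueDensity p.1 p.2 := by
  unfold obliqueDensity; fun_prop

theorem monotone_triCdf : Monotone triCdf :=
  monotone_of_deriv_nonneg (fun u => (hasDerivAt_triCdf u).differentiableAt)
    fun u => by rw [(hasDerivAt_triCdf u).deriv]; exact le_max_left _ _

theorem obliqueDensity_nonneg (a b : ℝ) : 0 ≤ obliqueDensity a b :=
  sub_nonneg.mpr (monotone_triCdf (sub_le_sub_left (le_max_left _ _) _))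

theorem obliqueDensity_of_le_two {a b : ℝ} (h : a ≤ 2) : obliqueDensity a b = 0 := by
  unfold obliqueDensity
  rw [max_eq_left (by linarith : a - 3 ≤ 0), min_eq_right (by linarith), max_eq_left (by linarith),
    sub_self]

theorem obliqueDensity_of_four_le {a b : ℝ} (h : 4 ≤ a) : obliqueDensity a b = 0 := by
  unfold obliqueDensity
  rw [max_eq_right (by linarith : 0 ≤ a - 3), min_eq_left (by linarith), max_eq_left (by linarith),
    sub_self]

/-- Here s runs over (0, a − 2). Reflecting one of the two values of `triCdf` exhibits the symmetry
b ↔ a − b. -/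
theorem obliqueDensity_of_mem_Icc_two_three {a b : ℝ} (h2 : 2 ≤ a) (h3 : a ≤ 3) :
    obliqueDensity a b = triCdf (a - b - 1) + triCdf (b - 1) - 1 := by
  unfold obliqueDensity
  rw [max_eq_left (by linarith : a - 3 ≤ 0), min_eq_right (by linarith),
    max_eq_right (by linarith), show b - 1 - (a - 2) = -(a - b - 1) by ring, triCdf_neg]
  ring_nf

theorem obliqueDensity_of_mem_Icc_three_four {a b : ℝ} (h3 : 3 ≤ a) (h4 : a ≤ 4) :
    obliqueDensity a b = 1 - triCdf (a - b - 2) - triCdf (b - 2) := by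
  unfold obliqueDensity
  rw [max_eq_right (by linarith : 0 ≤ a - 3), min_eq_left (by linarith),
    max_eq_right (by linarith), show b - 1 - (a - 3) = -(a - b - 2) by ring, triCdf_neg]
  ring_nf

/-! ### The angular integral and its primitives. -/

/-- The integral of `obliqueDensity` over the directions, at the distance `√3 / 2 * ρ`. -/
noncomputable def angularIntegral (ρ : ℝ) : ℝ :=
  ∫ θ in (-Real.pi)..Real.pi,
    obliqueDensity (ρ * Real.cos θ) (ρ * Real.cos (θ + Real.pi / 3))

theorem angularIntegral_nonneg (ρ : ℝ) : 0 ≤ angularIntegral ρ :=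
  intervalIntegral.integral_nonneg (by linarith [Real.pi_pos])
    fun _ _ => obliqueDensity_nonneg _ _

/-- The two caps that symmetric directions cut off. -/
noncomputable def capPair (ρ k θ : ℝ) : ℝ :=
  capIntegral ρ k (θ - Real.pi / 3) + capIntegral ρ k (θ + Real.pi / 3)

/-- A primitive of the angular density where the abscissa lies between `2` and `3`. -/
noncomputable def innerPrimitive (ρ θ : ℝ) : ℝ :=
  (capPair ρ 0 θ - 2 * capPair ρ 1 θ + capPair ρ 2 θ) / 2 - θ

/-- A primitive of the angular density where the abscissa lies between `3` and `4`. -/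
noncomputable def outerPrimitive (ρ θ : ℝ) : ℝ :=
  θ - (capPair ρ 1 θ - 2 * capPair ρ 2 θ + capPair ρ 3 θ) / 2

theorem hasDerivAt_capPair (ρ k θ : ℝ) : HasDerivAt (capPair ρ k)
    ((max 0 (ρ * Real.cos (θ - Real.pi / 3) - k)) ^ 2 +
      (max 0 (ρ * Real.cos (θ + Real.pi / 3) - k)) ^ 2) θ := by
  have h1 := (hasDerivAt_capIntegral ρ k (θ - Real.pi / 3)).comp_sub_const θ (Real.pi / 3)
  have h2 := (hasDerivAt_capIntegral ρ k (θ + Real.pi / 3)).comp_add_const θ (Real.pi / 3)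
  exact h1.add h2

theorem hasDerivAt_innerPrimitive (ρ θ : ℝ) : HasDerivAt (innerPrimitive ρ)
    (triCdf (ρ * Real.cos (θ - Real.pi / 3) - 1) +
      triCdf (ρ * Real.cos (θ + Real.pi / 3) - 1) - 1) θ := by
  have h := ((((hasDerivAt_capPair ρ 0 θ).sub ((hasDerivAt_capPair ρ 1 θ).const_mul 2)).add
    (hasDerivAt_capPair ρ 2 θ)).div_const 2).sub (hasDerivAt_id θ)
  refine h.congr_deriv ?_
  unfold triCdf
  rw [show ∀ x : ℝ, x - 1 + 1 = x - 0 by intro x; ring, show ∀ x : ℝ, x - 1 + 1 = x - 0 by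
    intro x; ring, show ∀ x : ℝ, x - 1 - 1 = x - 2 by intro x; ring,
    show ∀ x : ℝ, x - 1 - 1 = x - 2 by intro x; ring]
  ring

theorem hasDerivAt_outerPrimitive (ρ θ : ℝ) : HasDerivAt (outerPrimitive ρ)
    (1 - triCdf (ρ * Real.cos (θ - Real.pi / 3) - 2) -
      triCdf (ρ * Real.cos (θ + Real.pi / 3) - 2)) θ := by
  have h := (hasDerivAt_id θ).sub ((((hasDerivAt_capPair ρ 1 θ).sub
    ((hasDerivAt_capPair ρ 2 θ).const_mul 2)).add (hasDerivAt_capPair ρ 3 θ)).div_const 2)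
  refine h.congr_deriv ?_
  unfold triCdf
  rw [show ∀ x : ℝ, x - 2 + 1 = x - 1 by intro x; ring, show ∀ x : ℝ, x - 2 + 1 = x - 1 by
    intro x; ring, show ∀ x : ℝ, x - 2 - 1 = x - 3 by intro x; ring,
    show ∀ x : ℝ, x - 2 - 1 = x - 3 by intro x; ring]
  ring

/-- The two arcs are opposite and the cap integral is odd. Thus both primitives vanish at 0, and a
boundary angle clamped to 0 contributes nothing. -/
theorem capPair_zero (ρ k : ℝ) : capPair ρ k 0 = 0 := by
  unfold capPair
  rw [zero_sub, zero_add, capIntegral_neg, neg_add_cancel]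

theorem innerPrimitive_zero (ρ : ℝ) : innerPrimitive ρ 0 = 0 := by
  simp [innerPrimitive, capPair_zero]

theorem outerPrimitive_zero (ρ : ℝ) : outerPrimitive ρ 0 = 0 := by
  simp [outerPrimitive, capPair_zero]

theorem cos_sub_cos_add_pi_div_three (ρ θ : ℝ) :
    ρ * Real.cos θ - ρ * Real.cos (θ + Real.pi / 3) = ρ * Real.cos (θ - Real.pi / 3) := by
  rw [Real.cos_add, Real.cos_sub, Real.cos_pi_div_three]; ring

theorem continuous_obliqueDensity_circle (ρ : ℝ) : Continuous fun θ : ℝ =>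
    obliqueDensity (ρ * Real.cos θ) (ρ * Real.cos (θ + Real.pi / 3)) := by
  unfold obliqueDensity; fun_prop

/-- Replacing θ by −θ exchanges b and a − b, under which the density is invariant. -/
theorem obliqueDensity_circle_neg (ρ θ : ℝ) :
    obliqueDensity (ρ * Real.cos (-θ)) (ρ * Real.cos (-θ + Real.pi / 3)) =
      obliqueDensity (ρ * Real.cos θ) (ρ * Real.cos (θ + Real.pi / 3)) := by
  have e1 : Real.cos (-θ + Real.pi / 3) = Real.cos (θ - Real.pi / 3) := by
    rw [← Real.cos_neg]; congr 1; ring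
  rw [Real.cos_neg, e1]
  have e2 := cos_sub_cos_add_pi_div_three ρ θ
  have e3 : ρ * Real.cos θ - ρ * Real.cos (θ - Real.pi / 3) = ρ * Real.cos (θ + Real.pi / 3) := by
    linarith
  rcases le_total (ρ * Real.cos θ) 2 with h | h
  · rw [obliqueDensity_of_le_two h, obliqueDensity_of_le_two h]
  rcases le_total 4 (ρ * Real.cos θ) with h4 | h4
  · rw [obliqueDensity_of_four_le h4, obliqueDensity_of_four_le h4]
  rcases le_total (ρ * Real.cos θ) 3 with h3 | h3
  · rw [obliqueDensity_of_mem_Icc_two_three h h3, obliqueDensity_of_mem_Icc_two_three h h3, e2, e3]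
    ring
  · rw [obliqueDensity_of_mem_Icc_three_four h3 h4, obliqueDensity_of_mem_Icc_three_four h3 h4,
      e2, e3]
    ring

theorem le_mul_cos_of_lt_arccos {ρ k θ : ℝ} (hρ : 0 < ρ) (h0 : 0 ≤ θ) (hπ : θ ≤ Real.pi)
    (h : θ < Real.arccos (k / ρ)) : k ≤ ρ * Real.cos θ := by
  by_contra hcon
  have := arccos_le_of_cos_le (x := k / ρ) h0 hπ
    (by rw [le_div_iff₀ hρ]; linarith [not_le.mp hcon])
  linarith

theorem mul_cos_le_of_arccos_lt {ρ k θ : ℝ} (hρ : 0 < ρ) (h0 : 0 ≤ θ) (hπ : θ ≤ Real.pi)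
    (h : Real.arccos (k / ρ) < θ) : ρ * Real.cos θ ≤ k := by
  by_contra hcon
  have := le_arccos_of_le_cos (x := k / ρ) h0 hπ
    (by rw [div_le_iff₀ hρ]; linarith [not_le.mp hcon])
  linarith

/-- By symmetry twice the integral over [0, π], which is cut where a = ρ cos θ equals 4, 3, 2. The
clamping of `Real.arccos` covers radii that do not reach some of these lines: the corresponding
piece is then an empty interval. -/
theorem angularIntegral_eq {ρ : ℝ} (hρ : 0 < ρ) :
    angularIntegral ρ = 2 * (innerPrimitive ρ (Real.arccos (2 / ρ)) -
      innerPrimitive ρ (Real.arccos (3 / ρ)) + outerPrimitive ρ (Real.arccos (3 / ρ)) -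
      outerPrimitive ρ (Real.arccos (4 / ρ))) := by
  set f : ℝ → ℝ := fun θ => obliqueDensity (ρ * Real.cos θ) (ρ * Real.cos (θ + Real.pi / 3))
    with hf
  have hcont : Continuous f := continuous_obliqueDensity_circle ρ
  have hint : ∀ a b : ℝ, IntervalIntegrable f volume a b := fun a b => hcont.intervalIntegrable a b
  have hhalf : angularIntegral ρ = 2 * ∫ θ in (0 : ℝ)..Real.pi, f θ := by
    have h1 : ∫ θ in (-Real.pi)..0, f θ = ∫ θ in (0 : ℝ)..Real.pi, f θ := by
      have := intervalIntegral.integral_comp_neg (a := 0) (b := Real.pi) f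
      rw [neg_zero] at this
      rw [← this]
      exact intervalIntegral.integral_congr fun θ _ => obliqueDensity_circle_neg ρ θ
    have h2 := intervalIntegral.integral_add_adjacent_intervals (hint (-Real.pi) 0)
      (hint 0 Real.pi)
    unfold angularIntegral
    rw [← h2, h1, two_mul]
  set A := Real.arccos (2 / ρ)
  set B := Real.arccos (3 / ρ)
  set C := Real.arccos (4 / ρ)
  have hC0 : 0 ≤ C := Real.arccos_nonneg _
  have hCB : C ≤ B := Real.antitone_arccos (by gcongr; norm_num)
  have hBA : B ≤ A := Real.antitone_arccos (by gcongr; norm_num)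
  have hAπ : A ≤ Real.pi := Real.arccos_le_pi _
  have i1 : ∫ θ in (0 : ℝ)..C, f θ = 0 := by
    have := intervalIntegral.integral_eq_sub_of_hasDerivAt_of_le hC0
      (f := fun _ => (0 : ℝ)) (f' := f) continuousOn_const
      (fun θ hθ => by
        have h4 := le_mul_cos_of_lt_arccos hρ hθ.1.le (by linarith [hθ.2]) hθ.2
        simp only [hf]
        rw [obliqueDensity_of_four_le h4]
        exact hasDerivAt_const θ (0 : ℝ)) (hint _ _)
    simpa using this
  have i2 : ∫ θ in C..B, f θ = outerPrimitive ρ B - outerPrimitive ρ C := by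
    refine intervalIntegral.integral_eq_sub_of_hasDerivAt_of_le hCB
      (fun θ _ => (hasDerivAt_outerPrimitive ρ θ).continuousAt.continuousWithinAt)
      (fun θ hθ => ?_) (hint _ _)
    have h3 := le_mul_cos_of_lt_arccos hρ (hC0.trans hθ.1.le) (by linarith [hθ.2]) hθ.2
    have h4 := mul_cos_le_of_arccos_lt hρ (hC0.trans hθ.1.le) (by linarith [hθ.2]) hθ.1
    simp only [hf]
    rw [obliqueDensity_of_mem_Icc_three_four h3 h4, cos_sub_cos_add_pi_div_three]
    exact hasDerivAt_outerPrimitive ρ θ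
  have i3 : ∫ θ in B..A, f θ = innerPrimitive ρ A - innerPrimitive ρ B := by
    refine intervalIntegral.integral_eq_sub_of_hasDerivAt_of_le hBA
      (fun θ _ => (hasDerivAt_innerPrimitive ρ θ).continuousAt.continuousWithinAt)
      (fun θ hθ => ?_) (hint _ _)
    have h0 : 0 ≤ θ := by linarith [hθ.1]
    have h3 := le_mul_cos_of_lt_arccos hρ h0 (by linarith [hθ.2]) hθ.2
    have h4 := mul_cos_le_of_arccos_lt hρ h0 (by linarith [hθ.2]) hθ.1
    simp only [hf]
    rw [obliqueDensity_of_mem_Icc_two_three h3 h4, cos_sub_cos_add_pi_div_three]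
    exact hasDerivAt_innerPrimitive ρ θ
  have i4 : ∫ θ in A..Real.pi, f θ = 0 := by
    have := intervalIntegral.integral_eq_sub_of_hasDerivAt_of_le hAπ
      (f := fun _ => (0 : ℝ)) (f' := f) continuousOn_const
      (fun θ hθ => by
        have h4 := mul_cos_le_of_arccos_lt hρ (by linarith [hθ.1]) hθ.2.le hθ.1
        simp only [hf]
        rw [obliqueDensity_of_le_two h4]
        exact hasDerivAt_const θ (0 : ℝ)) (hint _ _)
    simpa using this
  have hsum : ∫ θ in (0 : ℝ)..Real.pi, f θ = (∫ θ in (0 : ℝ)..C, f θ) + (∫ θ in C..B, f θ) +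
      (∫ θ in B..A, f θ) + ∫ θ in A..Real.pi, f θ := by
    rw [intervalIntegral.integral_add_adjacent_intervals (hint 0 C) (hint C B),
      intervalIntegral.integral_add_adjacent_intervals (hint 0 B) (hint B A),
      intervalIntegral.integral_add_adjacent_intervals (hint 0 A) (hint A Real.pi)]
  rw [hhalf, hsum, i1, i2, i3, i4]
  ring

/-! ### Cap integrals at the boundary angles arccos(j/ρ) ± π/3. -/

section arcs

variable {ρ j k : ℝ}

theorem mul_cos_arccos_div (hρ : 0 < ρ) (hj : 0 ≤ j) (hjρ : j ≤ ρ) :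
    ρ * Real.cos (Real.arccos (j / ρ)) = j := by
  rw [Real.cos_arccos (by linarith [div_nonneg hj hρ.le]) ((div_le_one hρ).mpr hjρ),
    mul_div_cancel₀ _ hρ.ne']

/-- No bound on j is needed: if |j| > ρ, both sides are 0 by the conventions for `Real.arccos` and
the square root. -/
theorem mul_sin_arccos_div (hρ : 0 < ρ) :
    ρ * Real.sin (Real.arccos (j / ρ)) = √(ρ ^ 2 - j ^ 2) := by
  rw [Real.sin_arccos, ← Real.sqrt_sq hρ.le, ← Real.sqrt_mul (sq_nonneg ρ), Real.sqrt_sq hρ.le]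
  congr 1
  field_simp

theorem mul_cos_arccos_div_add (hρ : 0 < ρ) (hj : 0 ≤ j) (hjρ : j ≤ ρ) :
    ρ * Real.cos (Real.arccos (j / ρ) + Real.pi / 3) = j / 2 - √3 / 2 * √(ρ ^ 2 - j ^ 2) := by
  rw [Real.cos_add, Real.cos_pi_div_three, Real.sin_pi_div_three]
  linear_combination (1 / 2) * mul_cos_arccos_div hρ hj hjρ -
    √3 / 2 * mul_sin_arccos_div (j := j) hρ

theorem mul_cos_arccos_div_sub (hρ : 0 < ρ) (hj : 0 ≤ j) (hjρ : j ≤ ρ) :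
    ρ * Real.cos (Real.arccos (j / ρ) - Real.pi / 3) = j / 2 + √3 / 2 * √(ρ ^ 2 - j ^ 2) := by
  rw [Real.cos_sub, Real.cos_pi_div_three, Real.sin_pi_div_three]
  linear_combination (1 / 2) * mul_cos_arccos_div hρ hj hjρ +
    √3 / 2 * mul_sin_arccos_div (j := j) hρ

theorem mul_sin_arccos_div_add (hρ : 0 < ρ) (hj : 0 ≤ j) (hjρ : j ≤ ρ) :
    ρ * Real.sin (Real.arccos (j / ρ) + Real.pi / 3) = √(ρ ^ 2 - j ^ 2) / 2 + √3 / 2 * j := by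
  rw [Real.sin_add, Real.cos_pi_div_three, Real.sin_pi_div_three]
  linear_combination √3 / 2 * mul_cos_arccos_div hρ hj hjρ +
    (1 / 2) * mul_sin_arccos_div (j := j) hρ

theorem mul_sin_arccos_div_sub (hρ : 0 < ρ) (hj : 0 ≤ j) (hjρ : j ≤ ρ) :
    ρ * Real.sin (Real.arccos (j / ρ) - Real.pi / 3) = √(ρ ^ 2 - j ^ 2) / 2 - √3 / 2 * j := by
  rw [Real.sin_sub, Real.cos_pi_div_three, Real.sin_pi_div_three]
  linear_combination -(√3 / 2) * mul_cos_arccos_div hρ hj hjρ +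
    (1 / 2) * mul_sin_arccos_div (j := j) hρ

theorem capPrimitive_eq_of_mul_cos_of_mul_sin {β x y : ℝ} (hx : ρ * Real.cos β = x)
    (hy : ρ * Real.sin β = y) :
    capPrimitive ρ k β = (ρ ^ 2 / 2 + k ^ 2) * β + x * y / 2 - 2 * k * y := by
  subst hx hy; unfold capPrimitive; ring

/-- The full half cap. -/
noncomputable def halfCap (ρ k : ℝ) : ℝ :=
  (ρ ^ 2 / 2 + k ^ 2) * Real.arccos (k / ρ) - 3 / 2 * k * √(ρ ^ 2 - k ^ 2)

theorem capPrimitive_arccos_div (hρ : 0 < ρ) (hk : 0 ≤ k) (hkρ : k ≤ ρ) :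
    capPrimitive ρ k (Real.arccos (k / ρ)) = halfCap ρ k := by
  rw [capPrimitive_eq_of_mul_cos_of_mul_sin (mul_cos_arccos_div hρ hk hkρ)
    (mul_sin_arccos_div hρ), halfCap]
  ring

theorem arccos_div_mem (hρ : 0 < ρ) (hj : 0 ≤ j) :
    0 ≤ Real.arccos (j / ρ) ∧ Real.arccos (j / ρ) ≤ Real.pi / 2 :=
  ⟨Real.arccos_nonneg _, Real.arccos_le_pi_div_two.mpr (div_nonneg hj hρ.le)⟩

/-- The hypothesis says that ρ cos of the endpoint is at most k, so the arc has swept the whole half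
cap. The reverse inequality leads to `capIntegral_add_eq`. -/
theorem capIntegral_add_eq_halfCap (hρ : 0 < ρ) (hj : 0 ≤ j) (hjρ : j ≤ ρ) (hk : 0 ≤ k)
    (hkρ : k ≤ ρ) (h : j / 2 - k ≤ √3 / 2 * √(ρ ^ 2 - j ^ 2)) :
    capIntegral ρ k (Real.arccos (j / ρ) + Real.pi / 3) = halfCap ρ k := by
  have := arccos_div_mem hρ hj
  have := Real.pi_pos
  rw [capIntegral_eq_capPrimitive_arccos hρ hk (by linarith) (by linarith),
    capPrimitive_arccos_div hρ hk hkρ]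
  rw [mul_cos_arccos_div_add hρ hj hjρ]
  linarith

theorem capIntegral_add_eq (hρ : 0 < ρ) (hj : 0 ≤ j) (hjρ : j ≤ ρ)
    (h : √3 / 2 * √(ρ ^ 2 - j ^ 2) ≤ j / 2 - k) :
    capIntegral ρ k (Real.arccos (j / ρ) + Real.pi / 3) =
      (ρ ^ 2 / 2 + k ^ 2) * (Real.arccos (j / ρ) + Real.pi / 3) +
        √3 * (2 * j ^ 2 - ρ ^ 2) / 8 - j * √(ρ ^ 2 - j ^ 2) / 4 -
        k * (√(ρ ^ 2 - j ^ 2) + √3 * j) := by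
  have := arccos_div_mem hρ hj
  have := Real.pi_pos
  rw [capIntegral_eq_capPrimitive hρ.le (abs_le.mpr ⟨by linarith, by linarith⟩),
    capPrimitive_eq_of_mul_cos_of_mul_sin (mul_cos_arccos_div_add hρ hj hjρ)
      (mul_sin_arccos_div_add hρ hj hjρ)]
  · have h3 : √3 ^ 2 = 3 := Real.sq_sqrt (by norm_num)
    have hs : √(ρ ^ 2 - j ^ 2) ^ 2 = ρ ^ 2 - j ^ 2 :=
      Real.sq_sqrt (sub_nonneg.mpr (pow_le_pow_left₀ hj hjρ 2))
    linear_combination -(√3 / 8) * hs - j * √(ρ ^ 2 - j ^ 2) / 8 * h3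
  · rw [mul_cos_arccos_div_add hρ hj hjρ]
    linarith

theorem capIntegral_sub_eq (hρ : 0 < ρ) (hj : 0 ≤ j) (hjρ : j ≤ ρ)
    (h : k - j / 2 ≤ √3 / 2 * √(ρ ^ 2 - j ^ 2)) :
    capIntegral ρ k (Real.arccos (j / ρ) - Real.pi / 3) =
      (ρ ^ 2 / 2 + k ^ 2) * (Real.arccos (j / ρ) - Real.pi / 3) -
        √3 * (2 * j ^ 2 - ρ ^ 2) / 8 - j * √(ρ ^ 2 - j ^ 2) / 4 -
        k * (√(ρ ^ 2 - j ^ 2) - √3 * j) := by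
  have := arccos_div_mem hρ hj
  have := Real.pi_pos
  rw [capIntegral_eq_capPrimitive hρ.le (abs_le.mpr ⟨by linarith, by linarith⟩),
    capPrimitive_eq_of_mul_cos_of_mul_sin (mul_cos_arccos_div_sub hρ hj hjρ)
      (mul_sin_arccos_div_sub hρ hj hjρ)]
  · have h3 : √3 ^ 2 = 3 := Real.sq_sqrt (by norm_num)
    have hs : √(ρ ^ 2 - j ^ 2) ^ 2 = ρ ^ 2 - j ^ 2 :=
      Real.sq_sqrt (sub_nonneg.mpr (pow_le_pow_left₀ hj hjρ 2))
    linear_combination (√3 / 8) * hs - j * √(ρ ^ 2 - j ^ 2) / 8 * h3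
  · rw [mul_cos_arccos_div_sub hρ hj hjρ]
    linarith

/-- The bound ρ ≤ 2j makes arccos(j/ρ) ≤ π/3, so the arc runs backwards. By oddness it is minus an
arc that has passed the cutoff arccos(k/ρ). -/
theorem capIntegral_sub_eq_neg_halfCap (hρ : 0 < ρ) (hj : 0 ≤ j) (hjρ : j ≤ ρ)
    (hρj : ρ ≤ 2 * j) (hk : 0 ≤ k) (hkρ : k ≤ ρ)
    (h : √3 / 2 * √(ρ ^ 2 - j ^ 2) ≤ k - j / 2) :
    capIntegral ρ k (Real.arccos (j / ρ) - Real.pi / 3) = -halfCap ρ k := by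
  have := arccos_div_mem hρ hj
  have := Real.pi_pos
  have h60 : Real.arccos (j / ρ) ≤ Real.pi / 3 := by
    refine arccos_le_of_cos_le (by linarith) (by linarith) ?_
    rw [Real.cos_pi_div_three, le_div_iff₀ hρ]
    linarith
  rw [← neg_sub, capIntegral_neg, capIntegral_eq_capPrimitive_arccos hρ hk (by linarith)
    (by linarith), capPrimitive_arccos_div hρ hk hkρ]
  rw [← Real.cos_neg, neg_sub, mul_cos_arccos_div_sub hρ hj hjρ]
  linarith

/-- With c = ±(k − j/2) and x = ρ² − j², this and the next lemma turn the case distinction for a cap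
into a comparison of ρ² with j² + (2k − j)²/3. -/
theorem le_sqrt_three_mul_sqrt {c x : ℝ} (hx : 4 * c ^ 2 ≤ 3 * x) : c ≤ √3 / 2 * √x := by
  rw [show √3 / 2 * √x = √(3 * x / 4) by
    rw [show 3 * x / 4 = 3 * (x / 2 ^ 2) by ring, Real.sqrt_mul (by norm_num),
      Real.sqrt_div' _ (by norm_num), Real.sqrt_sq (by norm_num)]; ring]
  exact Real.le_sqrt_of_sq_le (by linarith)

theorem sqrt_three_mul_sqrt_le {c x : ℝ} (hc : 0 ≤ c) (hx : 3 * x ≤ 4 * c ^ 2) :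
    √3 / 2 * √x ≤ c := by
  rw [show √3 / 2 * √x = √(3 * x / 4) by
    rw [show 3 * x / 4 = 3 * (x / 2 ^ 2) by ring, Real.sqrt_mul (by norm_num),
      Real.sqrt_div' _ (by norm_num), Real.sqrt_sq (by norm_num)]; ring]
  exact Real.sqrt_le_iff.mpr ⟨hc, by linarith⟩

theorem sqrt_three_mul_sqrt_of_nonpos {c x : ℝ} (hc : c ≤ 0) : c ≤ √3 / 2 * √x :=
  hc.trans (by positivity)

theorem arccos_div_eq_zero (hρ : 0 < ρ) (h : ρ ≤ j) : Real.arccos (j / ρ) = 0 :=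
  Real.arccos_eq_zero.mpr ((one_le_div hρ).mpr h)

theorem halfCap_zero : halfCap ρ 0 = ρ ^ 2 * Real.pi / 4 := by
  simp [halfCap]; ring

theorem div_sqrt_three (c : ℝ) : c / √3 = c * √3 / 3 := by
  rw [div_eq_div_iff (by positivity) (by norm_num), mul_assoc, Real.mul_self_sqrt (by norm_num)]

theorem arcsin_eq (x : ℝ) : Real.arcsin x = Real.pi / 2 - Real.arccos x := by
  rw [Real.arccos]; ring

theorem sqrt_three_half_mul_sq (ρ : ℝ) : (√3 / 2 * ρ) ^ 2 = 3 / 4 * ρ ^ 2 := by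
  have h3 : √3 ^ 2 = 3 := Real.sq_sqrt (by norm_num)
  linear_combination ρ ^ 2 / 4 * h3

theorem sqrt_three_div_two_mul (ρ : ℝ) : √3 / (2 * (√3 / 2 * ρ)) = 1 / ρ := by
  field_simp

theorem sqrt_three_div (ρ : ℝ) : √3 / (√3 / 2 * ρ) = 2 / ρ := by
  field_simp

theorem three_sqrt_three_div_two_mul (ρ : ℝ) : 3 * √3 / (2 * (√3 / 2 * ρ)) = 3 / ρ := by
  field_simp

theorem two_sqrt_three_div (ρ : ℝ) : 2 * √3 / (√3 / 2 * ρ) = 4 / ρ := by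
  field_simp; norm_num

theorem sqrt_four_mul_sub (c x : ℝ) : √(4 * (3 / 4 * x) - 3 * c) = √3 * √(x - c) := by
  rw [← Real.sqrt_mul (by norm_num)]
  congr 1; ring

theorem sqrt_sub_three_quarters (c x : ℝ) : √(3 / 4 * x - 3 / 4 * c) = √3 / 2 * √(x - c) := by
  rw [show 3 / 4 * x - 3 / 4 * c = 3 * ((x - c) / 2 ^ 2) by ring, Real.sqrt_mul (by norm_num),
    Real.sqrt_div' _ (by norm_num), Real.sqrt_sq (by norm_num)]
  ring

theorem sqrt_four_mul_sub_three (x : ℝ) : √(4 * (3 / 4 * x) - 3) = √3 * √(x - 1 ^ 2) := by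
  rw [← sqrt_four_mul_sub]; norm_num

theorem sqrt_four_mul_sub_twentySeven (x : ℝ) :
    √(4 * (3 / 4 * x) - 27) = √3 * √(x - 3 ^ 2) := by
  rw [← sqrt_four_mul_sub]; norm_num

theorem sqrt_sub_three (x : ℝ) : √(3 / 4 * x - 3) = √3 / 2 * √(x - 2 ^ 2) := by
  rw [← sqrt_sub_three_quarters]; norm_num

theorem sqrt_sub_twelve (x : ℝ) : √(3 / 4 * x - 12) = √3 / 2 * √(x - 4 ^ 2) := by
  rw [← sqrt_sub_three_quarters]; norm_num

end arcs

/-! ### The six formulas in the variable ρ = 2d/√3. -/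

theorem hePiece1_eq (ρ : ℝ) : hePiece1 (√3 / 2 * ρ) = ρ *
    (2 * (ρ ^ 2 / 2 + 1) * Real.arcsin (1 / ρ) + 4 * Real.arcsin (2 / ρ) - (√3 / 4 + Real.pi /
      6) * ρ ^ 2 + 3 * √(ρ ^ 2 - 1 ^ 2) + 2 * √(ρ ^ 2 - 2 ^ 2) - 7 * Real.pi / 3 - 2 * √3) := by
  have h2 : √3 ^ 2 = 3 := Real.sq_sqrt (by norm_num)
  simp only [hePiece1, sqrt_three_div_two_mul, sqrt_three_div, sqrt_three_half_mul_sq,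
    sqrt_four_mul_sub_three, sqrt_sub_three]
  simp only [div_mul_eq_div_div, div_sqrt_three]
  -- With √3 opaque, `ring_nf` collects its products as powers of `t`, and `h2` replaces the square
  -- by 3.
  generalize √3 = t at *
  ring_nf
  simp only [h2]
  ring

theorem hePiece2_eq (ρ : ℝ) : hePiece2 (√3 / 2 * ρ) = ρ *
    (2 * (ρ ^ 2 / 2 + 1) * Real.arcsin (1 / ρ) - 2 * (ρ ^ 2 / 4 + 2) * Real.arcsin (2 / ρ) + 3
      * √(ρ ^ 2 - 1 ^ 2) - 3 * √(ρ ^ 2 - 2 ^ 2) + Real.pi / 3) := by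
  have h2 : √3 ^ 2 = 3 := Real.sq_sqrt (by norm_num)
  simp only [hePiece2, sqrt_three_div_two_mul, sqrt_three_div, sqrt_three_half_mul_sq,
    sqrt_four_mul_sub_three, sqrt_sub_three]
  simp only [div_mul_eq_div_div, div_sqrt_three]
  generalize √3 = t at *
  ring_nf
  simp only [h2]
  ring

theorem hePiece3_eq (ρ : ℝ) : hePiece3 (√3 / 2 * ρ) = ρ *
    (2 * (ρ ^ 2 / 2 + 1) * Real.arcsin (1 / ρ) - 2 * (ρ ^ 2 / 4 + 2) * Real.arcsin (2 / ρ) - 6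
      * Real.arcsin (3 / ρ) + 3 * √(ρ ^ 2 - 1 ^ 2) - 3 * √(ρ ^ 2 - 2 ^ 2) - 2 * √(ρ ^ 2 - 3 ^ 2)
      + 10 * Real.pi / 3) := by
  have h2 : √3 ^ 2 = 3 := Real.sq_sqrt (by norm_num)
  simp only [hePiece3, sqrt_three_div_two_mul, sqrt_three_div, three_sqrt_three_div_two_mul,
    sqrt_three_half_mul_sq, sqrt_four_mul_sub_three, sqrt_sub_three,
    sqrt_four_mul_sub_twentySeven]
  simp only [div_mul_eq_div_div, div_sqrt_three]
  generalize √3 = t at *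
  ring_nf
  simp only [h2]
  ring

theorem hePiece4_eq (ρ : ℝ) : hePiece4 (√3 / 2 * ρ) = ρ *
    ((ρ ^ 2 / 2 + 1) * Real.arcsin (1 / ρ) - 4 * (ρ ^ 2 / 4 + 2) * Real.arcsin (2 / ρ) - 9 *
      Real.arcsin (3 / ρ) + (√3 / 4 + Real.pi / 6) * ρ ^ 2 + 3 / 2 * √(ρ ^ 2 - 1 ^ 2) - 6 * √(ρ
      ^ 2 - 2 ^ 2) - 3 * √(ρ ^ 2 - 3 ^ 2) + 17 * Real.pi / 3 + 9 / 2 * √3) := by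
  have h2 : √3 ^ 2 = 3 := Real.sq_sqrt (by norm_num)
  simp only [hePiece4, sqrt_three_div_two_mul, sqrt_three_div, three_sqrt_three_div_two_mul,
    sqrt_three_half_mul_sq, sqrt_four_mul_sub_three, sqrt_sub_three,
    sqrt_four_mul_sub_twentySeven]
  simp only [div_mul_eq_div_div, div_sqrt_three]
  generalize √3 = t at *
  ring_nf
  simp only [h2]
  ring

theorem hePiece5_eq (ρ : ℝ) : hePiece5 (√3 / 2 * ρ) = ρ *
    ((ρ ^ 2 / 2 + 1) * Real.arcsin (1 / ρ) - 4 * (ρ ^ 2 / 4 + 2) * Real.arcsin (2 / ρ) + (ρ ^ 2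
      / 2 + 9) * Real.arcsin (3 / ρ) + 3 / 2 * √(ρ ^ 2 - 1 ^ 2) - 6 * √(ρ ^ 2 - 2 ^ 2) + 9 / 2 *
      √(ρ ^ 2 - 3 ^ 2) - Real.pi / 3) := by
  have h2 : √3 ^ 2 = 3 := Real.sq_sqrt (by norm_num)
  simp only [hePiece5, sqrt_three_div_two_mul, sqrt_three_div, three_sqrt_three_div_two_mul,
    sqrt_three_half_mul_sq, sqrt_four_mul_sub_three, sqrt_sub_three,
    sqrt_four_mul_sub_twentySeven]
  simp only [div_mul_eq_div_div, div_sqrt_three]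
  generalize √3 = t at *
  ring_nf
  simp only [h2]
  ring

theorem hePiece6_eq (ρ : ℝ) : hePiece6 (√3 / 2 * ρ) = ρ *
    ((ρ ^ 2 / 2 + 1) * Real.arcsin (1 / ρ) + (ρ ^ 2 / 2 + 9) * Real.arcsin (3 / ρ) + 8 *
      Real.arcsin (4 / ρ) - (√3 / 4 + Real.pi / 6) * ρ ^ 2 + 3 / 2 * √(ρ ^ 2 - 1 ^ 2) + 9 / 2 *
      √(ρ ^ 2 - 3 ^ 2) + 2 * √(ρ ^ 2 - 4 ^ 2) - 17 * Real.pi / 3 - 8 * √3) := by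
  have h2 : √3 ^ 2 = 3 := Real.sq_sqrt (by norm_num)
  simp only [hePiece6, sqrt_three_div_two_mul, three_sqrt_three_div_two_mul,
    two_sqrt_three_div, sqrt_three_half_mul_sq, sqrt_four_mul_sub_three,
    sqrt_four_mul_sub_twentySeven, sqrt_sub_twelve]
  simp only [div_mul_eq_div_div, div_sqrt_three]
  generalize √3 = t at *
  ring_nf
  simp only [h2]
  ring

/-! ### Evaluation of the angular integral on each range of ρ. -/

/-- The circle meets only the line a = 2, so the terms for j = 3 and j = 4 vanish. In this and the
following evaluations, each pair (j, k) is put in the regime dictated by its threshold j² + (2k −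
j)²/3. For j = 2 the thresholds are 16/3 (k = 0, 2) and 4 (k = 1). -/
theorem mul_angularIntegral_eq_hePiece1 {ρ : ℝ} (hρ : 0 < ρ) (h1 : 4 ≤ ρ ^ 2)
    (h2 : ρ ^ 2 ≤ 16/3) : ρ * angularIntegral ρ = hePiece1 (√3 / 2 * ρ) := by
  have l2 : 2 ≤ ρ := le_of_sq_le_sq (by linarith) hρ.le
  have u3 : ρ ≤ 3 := le_of_sq_le_sq (by linarith) (by norm_num)
  rw [angularIntegral_eq hρ, arccos_div_eq_zero hρ u3, arccos_div_eq_zero hρ (by linarith : ρ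
    ≤ 4), innerPrimitive_zero, outerPrimitive_zero]
  unfold innerPrimitive capPair
  rw [capIntegral_sub_eq hρ (j := 2) (k := 0) (by norm_num) l2
      (sqrt_three_mul_sqrt_of_nonpos (by norm_num)),
    capIntegral_add_eq hρ (j := 2) (k := 0) (by norm_num) l2
      (sqrt_three_mul_sqrt_le (by norm_num) (by norm_num; linarith)),
    capIntegral_sub_eq hρ (j := 2) (k := 1) (by norm_num) l2
      (sqrt_three_mul_sqrt_of_nonpos (by norm_num)),
    capIntegral_add_eq_halfCap hρ (j := 2) (k := 1) (by norm_num) l2 (by norm_num) (by linarith)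
      (sqrt_three_mul_sqrt_of_nonpos (by norm_num)),
    capIntegral_sub_eq_neg_halfCap hρ (j := 2) (k := 2) (by norm_num) l2 (by linarith) (by norm_num)
      (by linarith) (sqrt_three_mul_sqrt_le (by norm_num) (by norm_num; linarith)),
    capIntegral_add_eq_halfCap hρ (j := 2) (k := 2) (by norm_num) l2 (by norm_num) (by linarith)
      (sqrt_three_mul_sqrt_of_nonpos (by norm_num))]
  rw [hePiece1_eq]
  simp only [halfCap, arcsin_eq]
  ring

theorem mul_angularIntegral_eq_hePiece2 {ρ : ℝ} (hρ : 0 < ρ) (h1 : 16/3 ≤ ρ ^ 2)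
    (h2 : ρ ^ 2 ≤ 9) : ρ * angularIntegral ρ = hePiece2 (√3 / 2 * ρ) := by
  have l2 : 2 ≤ ρ := le_of_sq_le_sq (by linarith) hρ.le
  have u3 : ρ ≤ 3 := le_of_sq_le_sq (by linarith) (by norm_num)
  rw [angularIntegral_eq hρ, arccos_div_eq_zero hρ u3, arccos_div_eq_zero hρ (by linarith : ρ
    ≤ 4), innerPrimitive_zero, outerPrimitive_zero]
  unfold innerPrimitive capPair
  rw [capIntegral_sub_eq hρ (j := 2) (k := 0) (by norm_num) l2
      (sqrt_three_mul_sqrt_of_nonpos (by norm_num)),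
    capIntegral_add_eq_halfCap hρ (j := 2) (k := 0) (by norm_num) l2 (by norm_num) (by linarith)
      (le_sqrt_three_mul_sqrt (by norm_num; linarith)),
    capIntegral_sub_eq hρ (j := 2) (k := 1) (by norm_num) l2
      (sqrt_three_mul_sqrt_of_nonpos (by norm_num)),
    capIntegral_add_eq_halfCap hρ (j := 2) (k := 1) (by norm_num) l2 (by norm_num) (by linarith)
      (sqrt_three_mul_sqrt_of_nonpos (by norm_num)),
    capIntegral_sub_eq hρ (j := 2) (k := 2) (by norm_num) l2
      (le_sqrt_three_mul_sqrt (by norm_num; linarith)),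
    capIntegral_add_eq_halfCap hρ (j := 2) (k := 2) (by norm_num) l2 (by norm_num) (by linarith)
      (sqrt_three_mul_sqrt_of_nonpos (by norm_num))]
  rw [hePiece2_eq, halfCap_zero]
  simp only [halfCap, arcsin_eq]
  ring

/-- From ρ = 3 on, the line a = 3 contributes to both primitives. Its thresholds are 28/3 for k = 1,
2 and 12 for k = 0, 3. -/
theorem mul_angularIntegral_eq_hePiece3 {ρ : ℝ} (hρ : 0 < ρ) (h1 : 9 ≤ ρ ^ 2)
    (h2 : ρ ^ 2 ≤ 28/3) : ρ * angularIntegral ρ = hePiece3 (√3 / 2 * ρ) := by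
  have l2 : 2 ≤ ρ := le_of_sq_le_sq (by linarith) hρ.le
  have l3 : 3 ≤ ρ := le_of_sq_le_sq (by linarith) hρ.le
  have u4 : ρ ≤ 4 := le_of_sq_le_sq (by linarith) (by norm_num)
  rw [angularIntegral_eq hρ, arccos_div_eq_zero hρ u4, outerPrimitive_zero (ρ := ρ)]
  unfold innerPrimitive outerPrimitive capPair
  rw [capIntegral_sub_eq hρ (j := 2) (k := 0) (by norm_num) l2
      (sqrt_three_mul_sqrt_of_nonpos (by norm_num)),
    capIntegral_add_eq_halfCap hρ (j := 2) (k := 0) (by norm_num) l2 (by norm_num) (by linarith)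
      (le_sqrt_three_mul_sqrt (by norm_num; linarith)),
    capIntegral_sub_eq hρ (j := 2) (k := 1) (by norm_num) l2
      (sqrt_three_mul_sqrt_of_nonpos (by norm_num)),
    capIntegral_add_eq_halfCap hρ (j := 2) (k := 1) (by norm_num) l2 (by norm_num) (by linarith)
      (sqrt_three_mul_sqrt_of_nonpos (by norm_num)),
    capIntegral_sub_eq hρ (j := 2) (k := 2) (by norm_num) l2
      (le_sqrt_three_mul_sqrt (by norm_num; linarith)),
    capIntegral_add_eq_halfCap hρ (j := 2) (k := 2) (by norm_num) l2 (by norm_num) (by linarith)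
      (sqrt_three_mul_sqrt_of_nonpos (by norm_num)),
    capIntegral_sub_eq hρ (j := 3) (k := 0) (by norm_num) l3
      (sqrt_three_mul_sqrt_of_nonpos (by norm_num)),
    capIntegral_add_eq hρ (j := 3) (k := 0) (by norm_num) l3
      (sqrt_three_mul_sqrt_le (by norm_num) (by norm_num; linarith)),
    capIntegral_sub_eq hρ (j := 3) (k := 1) (by norm_num) l3
      (sqrt_three_mul_sqrt_of_nonpos (by norm_num)),
    capIntegral_add_eq hρ (j := 3) (k := 1) (by norm_num) l3
      (sqrt_three_mul_sqrt_le (by norm_num) (by norm_num; linarith)),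
    capIntegral_sub_eq_neg_halfCap hρ (j := 3) (k := 2) (by norm_num) l3 (by linarith) (by norm_num)
      (by linarith) (sqrt_three_mul_sqrt_le (by norm_num) (by norm_num; linarith)),
    capIntegral_add_eq_halfCap hρ (j := 3) (k := 2) (by norm_num) l3 (by norm_num) (by linarith)
      (sqrt_three_mul_sqrt_of_nonpos (by norm_num)),
    capIntegral_sub_eq_neg_halfCap hρ (j := 3) (k := 3) (by norm_num) l3 (by linarith) (by norm_num)
      (by linarith) (sqrt_three_mul_sqrt_le (by norm_num) (by norm_num; linarith)),
    capIntegral_add_eq_halfCap hρ (j := 3) (k := 3) (by norm_num) l3 (by norm_num) (by linarith)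
      (sqrt_three_mul_sqrt_of_nonpos (by norm_num))]
  rw [hePiece3_eq, halfCap_zero]
  simp only [halfCap, arcsin_eq]
  ring

theorem mul_angularIntegral_eq_hePiece4 {ρ : ℝ} (hρ : 0 < ρ) (h1 : 28/3 ≤ ρ ^ 2)
    (h2 : ρ ^ 2 ≤ 12) : ρ * angularIntegral ρ = hePiece4 (√3 / 2 * ρ) := by
  have l2 : 2 ≤ ρ := le_of_sq_le_sq (by linarith) hρ.le
  have l3 : 3 ≤ ρ := le_of_sq_le_sq (by linarith) hρ.le
  have u4 : ρ ≤ 4 := le_of_sq_le_sq (by linarith) (by norm_num)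
  rw [angularIntegral_eq hρ, arccos_div_eq_zero hρ u4, outerPrimitive_zero (ρ := ρ)]
  unfold innerPrimitive outerPrimitive capPair
  rw [capIntegral_sub_eq hρ (j := 2) (k := 0) (by norm_num) l2
      (sqrt_three_mul_sqrt_of_nonpos (by norm_num)),
    capIntegral_add_eq_halfCap hρ (j := 2) (k := 0) (by norm_num) l2 (by norm_num) (by linarith)
      (le_sqrt_three_mul_sqrt (by norm_num; linarith)),
    capIntegral_sub_eq hρ (j := 2) (k := 1) (by norm_num) l2
      (sqrt_three_mul_sqrt_of_nonpos (by norm_num)),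
    capIntegral_add_eq_halfCap hρ (j := 2) (k := 1) (by norm_num) l2 (by norm_num) (by linarith)
      (sqrt_three_mul_sqrt_of_nonpos (by norm_num)),
    capIntegral_sub_eq hρ (j := 2) (k := 2) (by norm_num) l2
      (le_sqrt_three_mul_sqrt (by norm_num; linarith)),
    capIntegral_add_eq_halfCap hρ (j := 2) (k := 2) (by norm_num) l2 (by norm_num) (by linarith)
      (sqrt_three_mul_sqrt_of_nonpos (by norm_num)),
    capIntegral_sub_eq hρ (j := 3) (k := 0) (by norm_num) l3
      (sqrt_three_mul_sqrt_of_nonpos (by norm_num)),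
    capIntegral_add_eq hρ (j := 3) (k := 0) (by norm_num) l3
      (sqrt_three_mul_sqrt_le (by norm_num) (by norm_num; linarith)),
    capIntegral_sub_eq hρ (j := 3) (k := 1) (by norm_num) l3
      (sqrt_three_mul_sqrt_of_nonpos (by norm_num)),
    capIntegral_add_eq_halfCap hρ (j := 3) (k := 1) (by norm_num) l3 (by norm_num) (by linarith)
      (le_sqrt_three_mul_sqrt (by norm_num; linarith)),
    capIntegral_sub_eq hρ (j := 3) (k := 2) (by norm_num) l3
      (le_sqrt_three_mul_sqrt (by norm_num; linarith)),
    capIntegral_add_eq_halfCap hρ (j := 3) (k := 2) (by norm_num) l3 (by norm_num) (by linarith)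
      (sqrt_three_mul_sqrt_of_nonpos (by norm_num)),
    capIntegral_sub_eq_neg_halfCap hρ (j := 3) (k := 3) (by norm_num) l3 (by linarith) (by norm_num)
      (by linarith) (sqrt_three_mul_sqrt_le (by norm_num) (by norm_num; linarith)),
    capIntegral_add_eq_halfCap hρ (j := 3) (k := 3) (by norm_num) l3 (by norm_num) (by linarith)
      (sqrt_three_mul_sqrt_of_nonpos (by norm_num))]
  rw [hePiece4_eq, halfCap_zero]
  simp only [halfCap, arcsin_eq]
  ring

theorem mul_angularIntegral_eq_hePiece5 {ρ : ℝ} (hρ : 0 < ρ) (h1 : 12 ≤ ρ ^ 2)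
    (h2 : ρ ^ 2 ≤ 16) : ρ * angularIntegral ρ = hePiece5 (√3 / 2 * ρ) := by
  have l2 : 2 ≤ ρ := le_of_sq_le_sq (by linarith) hρ.le
  have l3 : 3 ≤ ρ := le_of_sq_le_sq (by linarith) hρ.le
  have u4 : ρ ≤ 4 := le_of_sq_le_sq (by linarith) (by norm_num)
  rw [angularIntegral_eq hρ, arccos_div_eq_zero hρ u4, outerPrimitive_zero (ρ := ρ)]
  unfold innerPrimitive outerPrimitive capPair
  rw [capIntegral_sub_eq hρ (j := 2) (k := 0) (by norm_num) l2
      (sqrt_three_mul_sqrt_of_nonpos (by norm_num)),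
    capIntegral_add_eq_halfCap hρ (j := 2) (k := 0) (by norm_num) l2 (by norm_num) (by linarith)
      (le_sqrt_three_mul_sqrt (by norm_num; linarith)),
    capIntegral_sub_eq hρ (j := 2) (k := 1) (by norm_num) l2
      (sqrt_three_mul_sqrt_of_nonpos (by norm_num)),
    capIntegral_add_eq_halfCap hρ (j := 2) (k := 1) (by norm_num) l2 (by norm_num) (by linarith)
      (sqrt_three_mul_sqrt_of_nonpos (by norm_num)),
    capIntegral_sub_eq hρ (j := 2) (k := 2) (by norm_num) l2
      (le_sqrt_three_mul_sqrt (by norm_num; linarith)),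
    capIntegral_add_eq_halfCap hρ (j := 2) (k := 2) (by norm_num) l2 (by norm_num) (by linarith)
      (sqrt_three_mul_sqrt_of_nonpos (by norm_num)),
    capIntegral_sub_eq hρ (j := 3) (k := 0) (by norm_num) l3
      (sqrt_three_mul_sqrt_of_nonpos (by norm_num)),
    capIntegral_add_eq_halfCap hρ (j := 3) (k := 0) (by norm_num) l3 (by norm_num) (by linarith)
      (le_sqrt_three_mul_sqrt (by norm_num; linarith)),
    capIntegral_sub_eq hρ (j := 3) (k := 1) (by norm_num) l3
      (sqrt_three_mul_sqrt_of_nonpos (by norm_num)),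
    capIntegral_add_eq_halfCap hρ (j := 3) (k := 1) (by norm_num) l3 (by norm_num) (by linarith)
      (le_sqrt_three_mul_sqrt (by norm_num; linarith)),
    capIntegral_sub_eq hρ (j := 3) (k := 2) (by norm_num) l3
      (le_sqrt_three_mul_sqrt (by norm_num; linarith)),
    capIntegral_add_eq_halfCap hρ (j := 3) (k := 2) (by norm_num) l3 (by norm_num) (by linarith)
      (sqrt_three_mul_sqrt_of_nonpos (by norm_num)),
    capIntegral_sub_eq hρ (j := 3) (k := 3) (by norm_num) l3
      (le_sqrt_three_mul_sqrt (by norm_num; linarith)),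
    capIntegral_add_eq_halfCap hρ (j := 3) (k := 3) (by norm_num) l3 (by norm_num) (by linarith)
      (sqrt_three_mul_sqrt_of_nonpos (by norm_num))]
  rw [hePiece5_eq, halfCap_zero]
  simp only [halfCap, arcsin_eq]
  ring

theorem mul_angularIntegral_eq_hePiece6 {ρ : ℝ} (hρ : 0 < ρ) (h1 : 16 ≤ ρ ^ 2)
    (h2 : ρ ^ 2 ≤ 52/3) : ρ * angularIntegral ρ = hePiece6 (√3 / 2 * ρ) := by
  have l2 : 2 ≤ ρ := le_of_sq_le_sq (by linarith) hρ.le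
  have l3 : 3 ≤ ρ := le_of_sq_le_sq (by linarith) hρ.le
  have l4 : 4 ≤ ρ := le_of_sq_le_sq (by linarith) hρ.le
  -- A crude bound, enough for the condition ρ ≤ 2 · 4 of the reversed half cap.
  have u6 : ρ ≤ 6 := le_of_sq_le_sq (by linarith) (by norm_num)
  rw [angularIntegral_eq hρ]
  unfold innerPrimitive outerPrimitive capPair
  rw [capIntegral_sub_eq hρ (j := 2) (k := 0) (by norm_num) l2
      (sqrt_three_mul_sqrt_of_nonpos (by norm_num)),
    capIntegral_add_eq_halfCap hρ (j := 2) (k := 0) (by norm_num) l2 (by norm_num) (by linarith)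
      (le_sqrt_three_mul_sqrt (by norm_num; linarith)),
    capIntegral_sub_eq hρ (j := 2) (k := 1) (by norm_num) l2
      (sqrt_three_mul_sqrt_of_nonpos (by norm_num)),
    capIntegral_add_eq_halfCap hρ (j := 2) (k := 1) (by norm_num) l2 (by norm_num) (by linarith)
      (sqrt_three_mul_sqrt_of_nonpos (by norm_num)),
    capIntegral_sub_eq hρ (j := 2) (k := 2) (by norm_num) l2
      (le_sqrt_three_mul_sqrt (by norm_num; linarith)),
    capIntegral_add_eq_halfCap hρ (j := 2) (k := 2) (by norm_num) l2 (by norm_num) (by linarith)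
      (sqrt_three_mul_sqrt_of_nonpos (by norm_num)),
    capIntegral_sub_eq hρ (j := 3) (k := 0) (by norm_num) l3
      (sqrt_three_mul_sqrt_of_nonpos (by norm_num)),
    capIntegral_add_eq_halfCap hρ (j := 3) (k := 0) (by norm_num) l3 (by norm_num) (by linarith)
      (le_sqrt_three_mul_sqrt (by norm_num; linarith)),
    capIntegral_sub_eq hρ (j := 3) (k := 1) (by norm_num) l3
      (sqrt_three_mul_sqrt_of_nonpos (by norm_num)),
    capIntegral_add_eq_halfCap hρ (j := 3) (k := 1) (by norm_num) l3 (by norm_num) (by linarith)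
      (le_sqrt_three_mul_sqrt (by norm_num; linarith)),
    capIntegral_sub_eq hρ (j := 3) (k := 2) (by norm_num) l3
      (le_sqrt_three_mul_sqrt (by norm_num; linarith)),
    capIntegral_add_eq_halfCap hρ (j := 3) (k := 2) (by norm_num) l3 (by norm_num) (by linarith)
      (sqrt_three_mul_sqrt_of_nonpos (by norm_num)),
    capIntegral_sub_eq hρ (j := 3) (k := 3) (by norm_num) l3
      (le_sqrt_three_mul_sqrt (by norm_num; linarith)),
    capIntegral_add_eq_halfCap hρ (j := 3) (k := 3) (by norm_num) l3 (by norm_num) (by linarith)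
      (sqrt_three_mul_sqrt_of_nonpos (by norm_num)),
    capIntegral_sub_eq hρ (j := 4) (k := 1) (by norm_num) l4
      (sqrt_three_mul_sqrt_of_nonpos (by norm_num)),
    capIntegral_add_eq hρ (j := 4) (k := 1) (by norm_num) l4
      (sqrt_three_mul_sqrt_le (by norm_num) (by norm_num; linarith)),
    capIntegral_sub_eq hρ (j := 4) (k := 2) (by norm_num) l4
      (sqrt_three_mul_sqrt_of_nonpos (by norm_num)),
    capIntegral_add_eq_halfCap hρ (j := 4) (k := 2) (by norm_num) l4 (by norm_num) (by linarith)
      (sqrt_three_mul_sqrt_of_nonpos (by norm_num)),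
    capIntegral_sub_eq_neg_halfCap hρ (j := 4) (k := 3) (by norm_num) l4 (by linarith) (by norm_num)
      (by linarith) (sqrt_three_mul_sqrt_le (by norm_num) (by norm_num; linarith)),
    capIntegral_add_eq_halfCap hρ (j := 4) (k := 3) (by norm_num) l4 (by norm_num) (by linarith)
      (sqrt_three_mul_sqrt_of_nonpos (by norm_num))]
  rw [hePiece6_eq, halfCap_zero]
  simp only [halfCap, arcsin_eq]
  ring

/-- At 52/3, the threshold for j = 4 and k = 1, 3, the last caps change regime, and all
contributions then cancel identically: the circle has left the support of the density. -/
theorem angularIntegral_eq_zero_of_le_sq {ρ : ℝ} (hρ : 0 < ρ) (h1 : 52/3 ≤ ρ ^ 2) :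
    angularIntegral ρ = 0 := by
  have l2 : 2 ≤ ρ := le_of_sq_le_sq (by linarith) hρ.le
  have l3 : 3 ≤ ρ := le_of_sq_le_sq (by linarith) hρ.le
  have l4 : 4 ≤ ρ := le_of_sq_le_sq (by linarith) hρ.le
  rw [angularIntegral_eq hρ]
  unfold innerPrimitive outerPrimitive capPair
  rw [capIntegral_sub_eq hρ (j := 2) (k := 0) (by norm_num) l2
      (sqrt_three_mul_sqrt_of_nonpos (by norm_num)),
    capIntegral_add_eq_halfCap hρ (j := 2) (k := 0) (by norm_num) l2 (by norm_num) (by linarith)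
      (le_sqrt_three_mul_sqrt (by norm_num; linarith)),
    capIntegral_sub_eq hρ (j := 2) (k := 1) (by norm_num) l2
      (sqrt_three_mul_sqrt_of_nonpos (by norm_num)),
    capIntegral_add_eq_halfCap hρ (j := 2) (k := 1) (by norm_num) l2 (by norm_num) (by linarith)
      (sqrt_three_mul_sqrt_of_nonpos (by norm_num)),
    capIntegral_sub_eq hρ (j := 2) (k := 2) (by norm_num) l2
      (le_sqrt_three_mul_sqrt (by norm_num; linarith)),
    capIntegral_add_eq_halfCap hρ (j := 2) (k := 2) (by norm_num) l2 (by norm_num) (by linarith)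
      (sqrt_three_mul_sqrt_of_nonpos (by norm_num)),
    capIntegral_sub_eq hρ (j := 3) (k := 0) (by norm_num) l3
      (sqrt_three_mul_sqrt_of_nonpos (by norm_num)),
    capIntegral_add_eq_halfCap hρ (j := 3) (k := 0) (by norm_num) l3 (by norm_num) (by linarith)
      (le_sqrt_three_mul_sqrt (by norm_num; linarith)),
    capIntegral_sub_eq hρ (j := 3) (k := 1) (by norm_num) l3
      (sqrt_three_mul_sqrt_of_nonpos (by norm_num)),
    capIntegral_add_eq_halfCap hρ (j := 3) (k := 1) (by norm_num) l3 (by norm_num) (by linarith)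
      (le_sqrt_three_mul_sqrt (by norm_num; linarith)),
    capIntegral_sub_eq hρ (j := 3) (k := 2) (by norm_num) l3
      (le_sqrt_three_mul_sqrt (by norm_num; linarith)),
    capIntegral_add_eq_halfCap hρ (j := 3) (k := 2) (by norm_num) l3 (by norm_num) (by linarith)
      (sqrt_three_mul_sqrt_of_nonpos (by norm_num)),
    capIntegral_sub_eq hρ (j := 3) (k := 3) (by norm_num) l3
      (le_sqrt_three_mul_sqrt (by norm_num; linarith)),
    capIntegral_add_eq_halfCap hρ (j := 3) (k := 3) (by norm_num) l3 (by norm_num) (by linarith)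
      (sqrt_three_mul_sqrt_of_nonpos (by norm_num)),
    capIntegral_sub_eq hρ (j := 4) (k := 1) (by norm_num) l4
      (sqrt_three_mul_sqrt_of_nonpos (by norm_num)),
    capIntegral_add_eq_halfCap hρ (j := 4) (k := 1) (by norm_num) l4 (by norm_num) (by linarith)
      (le_sqrt_three_mul_sqrt (by norm_num; linarith)),
    capIntegral_sub_eq hρ (j := 4) (k := 2) (by norm_num) l4
      (sqrt_three_mul_sqrt_of_nonpos (by norm_num)),
    capIntegral_add_eq_halfCap hρ (j := 4) (k := 2) (by norm_num) l4 (by norm_num) (by linarith)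
      (sqrt_three_mul_sqrt_of_nonpos (by norm_num)),
    capIntegral_sub_eq hρ (j := 4) (k := 3) (by norm_num) l4
      (le_sqrt_three_mul_sqrt (by norm_num; linarith)),
    capIntegral_add_eq_halfCap hρ (j := 4) (k := 3) (by norm_num) l4 (by norm_num) (by linarith)
      (sqrt_three_mul_sqrt_of_nonpos (by norm_num))]
  rw [halfCap_zero]
  simp only [halfCap]
  ring

theorem angularIntegral_eq_zero_of_sq_le {ρ : ℝ} (hρ : 0 < ρ) (h : ρ ^ 2 ≤ 4) :
    angularIntegral ρ = 0 := by
  have u2 : ρ ≤ 2 := le_of_sq_le_sq (by linarith) (by norm_num)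
  rw [angularIntegral_eq hρ, arccos_div_eq_zero hρ u2,
    arccos_div_eq_zero hρ (by linarith : ρ ≤ 3), arccos_div_eq_zero hρ (by linarith : ρ ≤ 4),
    innerPrimitive_zero, outerPrimitive_zero]
  norm_num

/-! ### The density as a function of the distance. -/

section density

variable {d : ℝ}

theorem two_div_sqrt_three_mul_sq (d : ℝ) : (2 / √3 * d) ^ 2 = 4 / 3 * d ^ 2 := by
  rw [mul_pow, div_pow, Real.sq_sqrt (by norm_num)]; norm_num

theorem sqrt_three_half_mul_two_div (d : ℝ) : √3 / 2 * (2 / √3 * d) = d := by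
  field_simp

theorem angular_eq_hePiece1 (hd : 0 < d) (h1 : 3 ≤ d ^ 2) (h2 : d ^ 2 ≤ 4) :
    2 / √3 * d * angularIntegral (2 / √3 * d) = hePiece1 d := by
  rw [mul_angularIntegral_eq_hePiece1 (by positivity), sqrt_three_half_mul_two_div] <;>
    rw [two_div_sqrt_three_mul_sq] <;> linarith

theorem angular_eq_hePiece2 (hd : 0 < d) (h1 : 4 ≤ d ^ 2) (h2 : d ^ 2 ≤ 27 / 4) :
    2 / √3 * d * angularIntegral (2 / √3 * d) = hePiece2 d := by
  rw [mul_angularIntegral_eq_hePiece2 (by positivity), sqrt_three_half_mul_two_div] <;>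
    rw [two_div_sqrt_three_mul_sq] <;> linarith

theorem angular_eq_hePiece3 (hd : 0 < d) (h1 : 27 / 4 ≤ d ^ 2) (h2 : d ^ 2 ≤ 7) :
    2 / √3 * d * angularIntegral (2 / √3 * d) = hePiece3 d := by
  rw [mul_angularIntegral_eq_hePiece3 (by positivity), sqrt_three_half_mul_two_div] <;>
    rw [two_div_sqrt_three_mul_sq] <;> linarith

theorem angular_eq_hePiece4 (hd : 0 < d) (h1 : 7 ≤ d ^ 2) (h2 : d ^ 2 ≤ 9) :
    2 / √3 * d * angularIntegral (2 / √3 * d) = hePiece4 d := by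
  rw [mul_angularIntegral_eq_hePiece4 (by positivity), sqrt_three_half_mul_two_div] <;>
    rw [two_div_sqrt_three_mul_sq] <;> linarith

theorem angular_eq_hePiece5 (hd : 0 < d) (h1 : 9 ≤ d ^ 2) (h2 : d ^ 2 ≤ 12) :
    2 / √3 * d * angularIntegral (2 / √3 * d) = hePiece5 d := by
  rw [mul_angularIntegral_eq_hePiece5 (by positivity), sqrt_three_half_mul_two_div] <;>
    rw [two_div_sqrt_three_mul_sq] <;> linarith

theorem angular_eq_hePiece6 (hd : 0 < d) (h1 : 12 ≤ d ^ 2) (h2 : d ^ 2 ≤ 13) :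
    2 / √3 * d * angularIntegral (2 / √3 * d) = hePiece6 d := by
  rw [mul_angularIntegral_eq_hePiece6 (by positivity), sqrt_three_half_mul_two_div] <;>
    rw [two_div_sqrt_three_mul_sq] <;> linarith

theorem three_sqrt_three_half_sq : (3 * √3 / 2) ^ 2 = 27 / 4 := by
  rw [div_pow, mul_pow, Real.sq_sqrt (by norm_num)]; norm_num

theorem two_sqrt_three_sq : (2 * √3) ^ 2 = 12 := by
  rw [mul_pow, Real.sq_sqrt (by norm_num)]; norm_num

theorem heDensity_of_nonpos (hd : d ≤ 0) : heDensity d = 0 := by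
  unfold heDensity
  rw [if_pos (hd.trans_lt (by positivity))]

theorem heDensity_eq (hd : 0 < d) :
    heDensity d = 2 / √3 * d * angularIntegral (2 / √3 * d) := by
  have s3 : √3 ^ 2 = 3 := Real.sq_sqrt (by norm_num)
  have s7 : √7 ^ 2 = 7 := Real.sq_sqrt (by norm_num)
  have s13 : √13 ^ 2 = 13 := Real.sq_sqrt (by norm_num)
  have up : ∀ {c : ℝ}, d ≤ c → d ^ 2 ≤ c ^ 2 := fun h => pow_le_pow_left₀ hd.le h 2
  have lo : ∀ {c : ℝ}, 0 ≤ c → c ≤ d → c ^ 2 ≤ d ^ 2 := fun h0 h => pow_le_pow_left₀ h0 h 2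
  unfold heDensity
  split_ifs with h1 h2 h3 h4 h5 h6 h7
  · have := up h1.le
    rw [angularIntegral_eq_zero_of_sq_le (by positivity), mul_zero]
    rw [two_div_sqrt_three_mul_sq]; linarith
  · have := up h2
    have := lo (by positivity) (not_lt.mp h1)
    rw [angular_eq_hePiece1 hd] <;> linarith
  · have := up h3
    have := lo (by positivity) (not_le.mp h2).le
    rw [three_sqrt_three_half_sq] at *
    rw [angular_eq_hePiece2 hd] <;> linarith
  · have := up h4
    have := lo (by positivity) (not_le.mp h3).le
    rw [three_sqrt_three_half_sq] at *
    rw [angular_eq_hePiece3 hd] <;> linarith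
  · have := up h5
    have := lo (by positivity) (not_le.mp h4).le
    rw [angular_eq_hePiece4 hd] <;> linarith
  · have := up h6
    have := lo (by positivity) (not_le.mp h5).le
    rw [two_sqrt_three_sq] at *
    rw [angular_eq_hePiece5 hd] <;> linarith
  · have := up h7
    have := lo (by positivity) (not_le.mp h6).le
    rw [two_sqrt_three_sq] at *
    rw [angular_eq_hePiece6 hd] <;> linarith
  · have := lo (by positivity) (not_le.mp h7).le
    rw [angularIntegral_eq_zero_of_le_sq (by positivity), mul_zero]
    rw [two_div_sqrt_three_mul_sq]; linarith

theorem heDensity_nonneg (d : ℝ) : 0 ≤ heDensity d := by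
  rcases le_or_gt d 0 with h | h
  · rw [heDensity_of_nonpos h]
  · rw [heDensity_eq h]
    exact mul_nonneg (by positivity) (angularIntegral_nonneg _)

/-- Neighbouring formulas both evaluate the same angular integral at the common endpoint, so no
values of arcsine have to be compared. -/
theorem hePieces_agree : hePiece1 2 = hePiece2 2 ∧
    hePiece2 (3 * √3 / 2) = hePiece3 (3 * √3 / 2) ∧
    hePiece3 (√7) = hePiece4 (√7) ∧ hePiece4 3 = hePiece5 3 ∧
    hePiece5 (2 * √3) = hePiece6 (2 * √3) := by
  have s7 : √7 ^ 2 = 7 := Real.sq_sqrt (by norm_num)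
  have s27 := three_sqrt_three_half_sq
  have s12 := two_sqrt_three_sq
  refine ⟨?_, ?_, ?_, ?_, ?_⟩
  · rw [← angular_eq_hePiece1, ← angular_eq_hePiece2] <;> norm_num
  · rw [← angular_eq_hePiece2, ← angular_eq_hePiece3] <;> first | positivity | linarith
  · rw [← angular_eq_hePiece3, ← angular_eq_hePiece4] <;> first | positivity | linarith
  · rw [← angular_eq_hePiece4, ← angular_eq_hePiece5] <;> norm_num
  · rw [← angular_eq_hePiece5, ← angular_eq_hePiece6] <;> first | positivity | linarith

end density

/-! ### Uniform distributions under affine maps. -/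

/-- The scaling factor cancels on normalisation; it has to be non-zero and finite for this in
`ENNReal`. Since `e` is a measurable equivalence, `s` need not be measurable. -/
theorem cond_image_of_map_eq_smul {α β : Type*} [MeasurableSpace α] [MeasurableSpace β]
    {μ : Measure α} {ν : Measure β} (e : α ≃ᵐ β) {κ : ENNReal} (h0 : κ ≠ 0) (htop : κ ≠ ⊤)
    (h : μ.map e = κ • ν) (s : Set α) : cond ν (e '' s) = (cond μ s).map e := by
  have hs : e ⁻¹' (e '' s) = s := e.injective.preimage_image s
  have hr : (μ.restrict s).map e = κ • ν.restrict (e '' s) := by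
    have := e.measurableEmbedding.restrict_map μ (e '' s)
    rw [hs, h, Measure.restrict_smul] at this
    exact this.symm
  have hm : μ s = κ * ν (e '' s) := by
    have := e.map_apply (μ := μ) (e '' s)
    rw [hs, h] at this
    simpa using this.symm
  rw [ProbabilityTheory.cond, ProbabilityTheory.cond, Measure.map_smul, hr, hm, smul_smul,
    ENNReal.mul_inv (Or.inl h0) (Or.inl htop), mul_comm κ⁻¹, mul_assoc, ENNReal.inv_mul_cancel h0 htop, mul_one]

/-- The uniform distribution on the unit interval. -/
noncomputable abbrev unitUniform : Measure ℝ := volume.restrict (Set.Ioo 0 1)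

instance : IsProbabilityMeasure unitUniform := ⟨by simp⟩

theorem cond_unit_square :
    cond (volume : Measure (ℝ × ℝ)) (Set.Ioo 0 1 ×ˢ Set.Ioo 0 1) =
      unitUniform.prod unitUniform := by
  rw [ProbabilityTheory.cond, Measure.prod_restrict, Measure.volume_eq_prod, Measure.prod_prod]
  simp

/-- A linear isomorphism carries Lebesgue measure to a Haar measure, hence to a multiple of Lebesgue
measure; its determinant need not be known. -/
theorem cond_image_unit_square (L : (ℝ × ℝ) ≃L[ℝ] Plane) (c : Plane) :
    cond volume ((fun p => c + L p) '' (Set.Ioo 0 1 ×ˢ Set.Ioo 0 1)) =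
      (unitUniform.prod unitUniform).map fun p => c + L p := by
  have hL : (volume.map L).IsAddHaarMeasure := L.isAddHaarMeasure_map volume
  obtain ⟨κ, h0, htop, h⟩ : ∃ κ : ENNReal, κ ≠ 0 ∧ κ ≠ ⊤ ∧ volume.map L = κ • volume :=
    ⟨Measure.addHaarScalarFactor (volume.map L) volume,
      ENNReal.coe_ne_zero.mpr
        (Measure.addHaarScalarFactor_pos_of_isAddHaarMeasure (volume.map L) volume).ne',
      ENNReal.coe_ne_top, Measure.isAddLeftInvariant_eq_smul (volume.map L) volume⟩
  let e : (ℝ × ℝ) ≃ᵐ Plane :=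
    L.toHomeomorph.toMeasurableEquiv.trans (Homeomorph.addLeft c).toMeasurableEquiv
  have he : (volume : Measure (ℝ × ℝ)).map e = κ • volume := by
    have : (e : ℝ × ℝ → Plane) = (fun x => c + x) ∘ L := rfl
    rw [this, ← Measure.map_map (measurable_const_add c) L.continuous.measurable, h,
      Measure.map_smul, map_add_left_eq_self]
  have := cond_image_of_map_eq_smul e h0 htop he (Set.Ioo 0 1 ×ˢ Set.Ioo 0 1)
  rw [cond_unit_square] at this
  exact this

theorem exists_continuousLinearEquiv_of_linearIndependent {v w : Plane}
    (h : v 0 * w 1 - v 1 * w 0 ≠ 0) :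
    ∃ L : (ℝ × ℝ) ≃L[ℝ] Plane, ∀ p, L p = p.1 • v + p.2 • w := by
  let f : (ℝ × ℝ) →ₗ[ℝ] Plane :=
    (LinearMap.fst ℝ ℝ ℝ).smulRight v + (LinearMap.snd ℝ ℝ ℝ).smulRight w
  have hf : ∀ p, f p = p.1 • v + p.2 • w := fun p => rfl
  have hinj : Function.Injective f := by
    rw [← LinearMap.ker_eq_bot, LinearMap.ker_eq_bot']
    intro p hp
    have h0 : p.1 * v 0 + p.2 * w 0 = 0 := by
      have := congrArg (fun x : Plane => x 0) hp
      simpa [hf] using this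
    have h1 : p.1 * v 1 + p.2 * w 1 = 0 := by
      have := congrArg (fun x : Plane => x 1) hp
      simpa [hf] using this
    have e1 : p.1 * (v 0 * w 1 - v 1 * w 0) = 0 := by linear_combination w 1 * h0 - w 0 * h1
    have e2 : p.2 * (v 0 * w 1 - v 1 * w 0) = 0 := by linear_combination v 0 * h1 - v 1 * h0
    exact Prod.ext ((mul_eq_zero.mp e1).resolve_right h) ((mul_eq_zero.mp e2).resolve_right h)
  refine ⟨(LinearEquiv.ofInjectiveOfFinrankEq f hinj (by simp)).toContinuousLinearEquiv,
    fun p => ?_⟩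
  exact hf p

theorem cond_hexRhombus (c : Plane) (k : ℕ)
    (h : hexVertex k 0 * hexVertex (k + 2) 1 - hexVertex k 1 * hexVertex (k + 2) 0 ≠ 0) :
    cond volume (hexRhombus c k) = (unitUniform.prod unitUniform).map
      fun p => c + p.1 • hexVertex k + p.2 • hexVertex (k + 2) := by
  obtain ⟨L, hL⟩ := exists_continuousLinearEquiv_of_linearIndependent h
  have e : (fun p : ℝ × ℝ => c + p.1 • hexVertex k + p.2 • hexVertex (k + 2)) =
      fun p => c + L p := by
    funext p; rw [hL, add_assoc]
  rw [e, ← cond_image_unit_square, ← e]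
  congr 1
  ext x
  constructor
  · rintro ⟨s, hs, t, ht, rfl⟩
    exact ⟨(s, t), ⟨hs, ht⟩, rfl⟩
  · rintro ⟨⟨s, t⟩, ⟨hs, ht⟩, rfl⟩
    exact ⟨s, hs, t, ht, rfl⟩

theorem cond_isometry_image (φ : Plane ≃ᵃⁱ[ℝ] Plane) (s : Set Plane) :
    cond volume (φ '' s) = (cond volume s).map φ := by
  have hφ : (volume : Measure Plane).map φ = (1 : ENNReal) • volume := by
    have e : (φ : Plane → Plane) = (fun x => x + φ 0) ∘ φ.linearIsometryEquiv := by
      funext x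
      simpa using φ.map_vadd 0 x
    rw [one_smul, e]
    exact ((measurePreserving_add_right volume (φ 0)).comp
      φ.linearIsometryEquiv.measurePreserving).map_eq
  exact cond_image_of_map_eq_smul φ.toHomeomorph.toMeasurableEquiv one_ne_zero ENNReal.one_ne_top
    hφ s

/-! ### The two rhombuses in coordinates. -/

theorem hexVertex_two : hexVertex 2 = !₂[-(√3 / 2), 1 / 2] := by
  have e : ((2 : ℕ) : ℝ) = 2 := by norm_num
  unfold hexVertex
  rw [e, show (2 * 2 + 1) * Real.pi / 6 = Real.pi - Real.pi / 6 by ring, Real.cos_pi_sub,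
    Real.sin_pi_sub, Real.cos_pi_div_six, Real.sin_pi_div_six]

theorem hexVertex_four : hexVertex 4 = !₂[0, -1] := by
  have e : ((4 : ℕ) : ℝ) = 4 := by norm_num
  unfold hexVertex
  rw [e, show (2 * 4 + 1) * Real.pi / 6 = Real.pi / 2 + Real.pi by ring, Real.cos_add_pi,
    Real.sin_add_pi, Real.cos_pi_div_two, Real.sin_pi_div_two, neg_zero]

theorem hexVertex_six : hexVertex 6 = !₂[√3 / 2, 1 / 2] := by
  have e : ((6 : ℕ) : ℝ) = 6 := by norm_num
  unfold hexVertex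
  rw [e, show (2 * 6 + 1) * Real.pi / 6 = Real.pi / 6 + 2 * Real.pi by ring, Real.cos_add_two_pi,
    Real.sin_add_two_pi, Real.cos_pi_div_six, Real.sin_pi_div_six]

theorem cond_rhombusH : cond volume rhombusH = (unitUniform.prod unitUniform).map
    fun p : ℝ × ℝ => 0 + p.1 • hexVertex 2 + p.2 • hexVertex 4 :=
  cond_hexRhombus 0 2 (by rw [hexVertex_two, hexVertex_four]; simp)

theorem cond_rhombusE : cond volume rhombusE = (unitUniform.prod unitUniform).map
    fun p : ℝ × ℝ => rightCentre + p.1 • hexVertex 4 + p.2 • hexVertex 6 :=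
  cond_hexRhombus rightCentre 4 (by rw [hexVertex_four, hexVertex_six]; simp)

/-- The difference is ±(√3/2 · a, a/2 − b) with a = q.2 + 2 + p.1 and b = q.1 + 1 + p.1 − p.2. -/
theorem dist_rhombi (p q : ℝ × ℝ) :
    dist ((0 : Plane) + p.1 • hexVertex 2 + p.2 • hexVertex 4)
      (rightCentre + q.1 • hexVertex 4 + q.2 • hexVertex 6) =
    √((q.2 + (2 + p.1)) ^ 2 - (q.2 + (2 + p.1)) * (q.1 + (1 + p.1 - p.2)) +
      (q.1 + (1 + p.1 - p.2)) ^ 2) := by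
  have h3 : √3 ^ 2 = 3 := Real.sq_sqrt (by norm_num)
  rw [EuclideanSpace.dist_eq, Fin.sum_univ_two, hexVertex_two, hexVertex_four, hexVertex_six,
    rightCentre, Real.dist_eq, Real.dist_eq, sq_abs, sq_abs]
  congr 1
  simp
  linear_combination (q.2 / 2 + 1 + p.1 / 2) ^ 2 * h3

/-! ### From the four uniform parameters to the density of the distance. -/

theorem lintegral_Ioo_indicator_translate (v : ℝ) :
    ∫⁻ t in Set.Ioo (0 : ℝ) 1, (Set.Ioo (0 : ℝ) 1).indicator 1 (v + t) =
      ENNReal.ofReal (max 0 (1 - |v|)) := by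
  have h : (fun t : ℝ => (Set.Ioo (0 : ℝ) 1).indicator (1 : ℝ → ENNReal) (v + t)) =
      (Set.Ioo (-v) (1 - v)).indicator 1 := by
    funext t
    simp only [Set.indicator, Set.mem_Ioo]
    congr 1
    apply propext
    constructor <;> rintro ⟨h1, h2⟩ <;> constructor <;> linarith
  rw [h, lintegral_indicator_one measurableSet_Ioo, Measure.restrict_apply measurableSet_Ioo,
    Set.Ioo_inter_Ioo, Real.volume_Ioo]
  rcases le_total 0 v with hv | hv
  · rw [abs_of_nonneg hv, max_eq_right (by linarith), min_eq_left (by linarith), sub_zero]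
    rw [max_comm, ENNReal.ofReal_max]; simp
  · rw [abs_of_nonpos hv, max_eq_left (by linarith), min_eq_right (by linarith)]
    rw [max_comm, ENNReal.ofReal_max]; simp

/-- Integrating over t gives the triangular density at b − 1 − s. The other indicator restricts s to
(a − 3, a − 2), and `triCdf` is the primitive. -/
theorem lintegral_unit_square_indicator (a b : ℝ) :
    ∫⁻ s in Set.Ioo (0 : ℝ) 1, ∫⁻ t in Set.Ioo (0 : ℝ) 1,
      (Set.Ioo (0 : ℝ) 1).indicator 1 (a - 2 - s) *
        (Set.Ioo (0 : ℝ) 1).indicator 1 (b - 1 - s + t) =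
      ENNReal.ofReal (obliqueDensity a b) := by
  have h1 : ∀ s : ℝ, ∫⁻ t in Set.Ioo (0 : ℝ) 1,
      (Set.Ioo (0 : ℝ) 1).indicator (1 : ℝ → ENNReal) (a - 2 - s) *
        (Set.Ioo (0 : ℝ) 1).indicator 1 (b - 1 - s + t) =
      (Set.Ioo (a - 3) (a - 2)).indicator
        (fun s => ENNReal.ofReal (max 0 (1 - |b - 1 - s|))) s := by
    intro s
    rw [lintegral_const_mul' _ _ (by simp only [Set.indicator]; split_ifs <;> simp),
      lintegral_Ioo_indicator_translate]
    by_cases hs : s ∈ Set.Ioo (a - 3) (a - 2)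
    · have : a - 2 - s ∈ Set.Ioo (0 : ℝ) 1 := ⟨by linarith [hs.2], by linarith [hs.1]⟩
      simp [hs, this]
    · have : a - 2 - s ∉ Set.Ioo (0 : ℝ) 1 := fun h => hs ⟨by linarith [h.2], by linarith [h.1]⟩
      simp [hs, this]
  simp_rw [h1]
  rw [lintegral_indicator measurableSet_Ioo, Measure.restrict_restrict measurableSet_Ioo,
    Set.Ioo_inter_Ioo, max_comm, min_comm]
  set s0 := max 0 (a - 3)
  set s1 := min 1 (a - 2)
  rcases le_total s1 s0 with h | h
  -- The range of s is empty; the outer maximum in `obliqueDensity` makes its two terms coincide.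
  · rw [Set.Ioo_eq_empty (not_lt.mpr h)]
    unfold obliqueDensity
    rw [max_eq_left h, sub_self]; simp
  · have hcont : Continuous fun s : ℝ => max 0 (1 - |b - 1 - s|) := by fun_prop
    have hd : ∀ s ∈ Set.uIcc s0 s1, HasDerivAt (fun s => -triCdf (b - 1 - s))
        (max 0 (1 - |b - 1 - s|)) s := fun s _ => by
      have := (hasDerivAt_triCdf (b - 1 - s)).comp_const_sub (b - 1) s
      exact this.neg.congr_deriv (neg_neg _)
    have := intervalIntegral.integral_eq_sub_of_hasDerivAt hd (hcont.intervalIntegrable _ _)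
    rw [intervalIntegral.integral_of_le h, ← restrict_Ioo_eq_restrict_Ioc] at this
    rw [← ofReal_integral_eq_lintegral_ofReal
      ((hcont.integrableOn_Icc (a := s0) (b := s1)).mono_set Set.Ioo_subset_Icc_self)
      (Filter.Eventually.of_forall fun s => le_max_left _ _), this]
    unfold obliqueDensity
    rw [max_eq_right h, neg_sub_neg]

/-- For fixed p, translation turns q into the pair z = (b, a), in this order. After the exchange of
integrals, the mass of the p that allow a given z is the oblique density. -/
theorem lintegral_unit_squares {F : ℝ × ℝ → ENNReal} (hF : Measurable F) :
    ∫⁻ p, ∫⁻ q, F (q.1 + (1 + p.1 - p.2), q.2 + (2 + p.1)) ∂(unitUniform.prod unitUniform)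
      ∂(unitUniform.prod unitUniform) =
    ∫⁻ z, ENNReal.ofReal (obliqueDensity z.2 z.1) * F z := by
  set I : Set ℝ := Set.Ioo 0 1
  have hI : MeasurableSet (I ×ˢ I) := measurableSet_Ioo.prod measurableSet_Ioo
  have hone : Measurable ((I ×ˢ I).indicator (1 : ℝ × ℝ → ENNReal)) :=
    measurable_one.indicator hI
  have h1 : ∀ p : ℝ × ℝ, ∫⁻ q, F (q.1 + (1 + p.1 - p.2), q.2 + (2 + p.1))
      ∂(unitUniform.prod unitUniform) =
      ∫⁻ z, (I ×ˢ I).indicator 1 (z - (1 + p.1 - p.2, 2 + p.1)) * F z := by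
    intro p
    rw [Measure.prod_restrict, ← lintegral_indicator hI]
    refine Eq.trans (lintegral_congr fun q => ?_) (lintegral_add_right_eq_self
      (fun z => (I ×ˢ I).indicator 1 (z - (1 + p.1 - p.2, 2 + p.1)) * F z)
      ((1 + p.1 - p.2, 2 + p.1) : ℝ × ℝ))
    rw [add_sub_cancel_right]
    by_cases hq : q ∈ I ×ˢ I
    · rw [Set.indicator_of_mem hq, Set.indicator_of_mem hq, Pi.one_apply, one_mul]; rfl
    · rw [Set.indicator_of_notMem hq, Set.indicator_of_notMem hq, zero_mul]
  simp_rw [h1]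
  rw [lintegral_lintegral_swap]
  · refine lintegral_congr fun z => ?_
    have hm : Measurable fun p : ℝ × ℝ =>
        (I ×ˢ I).indicator (1 : ℝ × ℝ → ENNReal) (z - (1 + p.1 - p.2, 2 + p.1)) :=
      hone.comp (by fun_prop)
    rw [lintegral_mul_const _ hm, lintegral_prod _ hm.aemeasurable,
      ← lintegral_unit_square_indicator]
    congr 1
    refine lintegral_congr fun s => lintegral_congr fun t => ?_
    have e1 : z.2 - (2 + s) = z.2 - 2 - s := by ring
    have e2 : z.1 - (1 + s - t) = z.1 - 1 - s + t := by ring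
    simp only [Set.indicator, Set.mem_prod, Prod.fst_sub, Prod.snd_sub, e1, e2, Pi.one_apply]
    by_cases ha : z.2 - 2 - s ∈ I <;> by_cases hb : z.1 - 1 - s + t ∈ I <;> simp [I, ha, hb]
  · refine Measurable.aemeasurable ?_
    exact (hone.comp (by fun_prop)).mul (hF.comp measurable_snd)

theorem lintegral_comp_mul_left {a : ℝ} (ha : 0 < a) {g : ℝ → ENNReal} (hg : Measurable g) :
    ∫⁻ x, g x = ENNReal.ofReal a * ∫⁻ x, g (a * x) := by
  conv_lhs => rw [← Real.smul_map_volume_mul_left ha.ne']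
  rw [lintegral_smul_measure, lintegral_map hg (measurable_const_mul a), abs_of_pos ha, smul_eq_mul]

theorem measurable_obliqueDensity :
    Measurable fun p : ℝ × ℝ => obliqueDensity p.1 p.2 :=
  continuous_obliqueDensity.measurable

/-- The substitution a = 2x/√3, b = a/2 − y: a dilation of one variable, which yields the Jacobian,
and a measure-preserving reflection of the other. It makes the quadratic form Euclidean. -/
theorem lintegral_oblique {f : ℝ → ENNReal} (hf : Measurable f) :
    ∫⁻ z : ℝ × ℝ, ENNReal.ofReal (obliqueDensity z.2 z.1) *
      f √(z.2 ^ 2 - z.2 * z.1 + z.1 ^ 2) =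
    ENNReal.ofReal (2 / √3) * ∫⁻ z : ℝ × ℝ,
      ENNReal.ofReal (obliqueDensity (2 / √3 * z.1) (2 / √3 * z.1 / 2 - z.2)) *
        f √(z.1 ^ 2 + z.2 ^ 2) := by
  have hm : Measurable fun z : ℝ × ℝ => ENNReal.ofReal (obliqueDensity z.2 z.1) *
      f √(z.2 ^ 2 - z.2 * z.1 + z.1 ^ 2) :=
    (measurable_obliqueDensity.comp measurable_swap).ennreal_ofReal.mul (hf.comp (by fun_prop))
  have hm' : Measurable fun z : ℝ × ℝ =>
      ENNReal.ofReal (obliqueDensity (2 / √3 * z.1) (2 / √3 * z.1 / 2 - z.2)) *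
        f √(z.1 ^ 2 + z.2 ^ 2) :=
    (measurable_obliqueDensity.comp (f := fun z : ℝ × ℝ =>
      (2 / √3 * z.1, 2 / √3 * z.1 / 2 - z.2)) (by fun_prop)).ennreal_ofReal.mul
      (hf.comp (by fun_prop))
  rw [Measure.volume_eq_prod, lintegral_prod_symm _ hm.aemeasurable,
    lintegral_prod _ hm'.aemeasurable,
    lintegral_comp_mul_left (a := 2 / √3) (by positivity) hm.lintegral_prod_left']
  congr 1
  refine lintegral_congr fun x => ?_
  rw [← lintegral_sub_left_eq_self _ (2 / √3 * x / 2)]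
  refine lintegral_congr fun y => ?_
  congr 3
  have := two_div_sqrt_three_mul_sq x
  dsimp only
  linear_combination (3 / 4) * this

/-- In polar coordinates the test function depends on the radius alone, so the integral over the
angle splits off; the polar Jacobian r and the factor 2/√3 combine to ρ. -/
theorem lintegral_polar {f : ℝ → ENNReal} (hf : Measurable f) :
    ENNReal.ofReal (2 / √3) * ∫⁻ z : ℝ × ℝ,
      ENNReal.ofReal (obliqueDensity (2 / √3 * z.1) (2 / √3 * z.1 / 2 - z.2)) *
        f √(z.1 ^ 2 + z.2 ^ 2) =
    ∫⁻ r, ENNReal.ofReal (heDensity r) * f r := by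
  rw [← lintegral_comp_polarCoord_symm, polarCoord_target, Measure.volume_eq_prod,
    ← Measure.prod_restrict]
  have hcongr : ∀ p : ℝ × ℝ, 0 < p.1 → ENNReal.ofReal p.1 •
      (ENNReal.ofReal (obliqueDensity (2 / √3 * (polarCoord.symm p).1)
        (2 / √3 * (polarCoord.symm p).1 / 2 - (polarCoord.symm p).2)) *
        f √((polarCoord.symm p).1 ^ 2 + (polarCoord.symm p).2 ^ 2)) =
      ENNReal.ofReal p.1 * f p.1 * ENNReal.ofReal (obliqueDensity
        (2 / √3 * p.1 * Real.cos p.2) (2 / √3 * p.1 * Real.cos (p.2 + Real.pi / 3))) := by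
    rintro ⟨r, θ⟩ hr
    have e1 : √((r * Real.cos θ) ^ 2 + (r * Real.sin θ) ^ 2) = r := by
      rw [mul_pow, mul_pow, ← mul_add, Real.cos_sq_add_sin_sq, mul_one, Real.sqrt_sq hr.le]
    have e2 : 2 / √3 * (r * Real.cos θ) / 2 - r * Real.sin θ =
        2 / √3 * r * Real.cos (θ + Real.pi / 3) := by
      rw [Real.cos_add, Real.cos_pi_div_three, Real.sin_pi_div_three]
      field_simp
    simp only [polarCoord_symm_apply]
    rw [e1, e2, smul_eq_mul, ← mul_assoc (2 / √3)]
    ring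
  have hm : Measurable fun p : ℝ × ℝ => ENNReal.ofReal p.1 * f p.1 *
      ENNReal.ofReal (obliqueDensity (2 / √3 * p.1 * Real.cos p.2)
        (2 / √3 * p.1 * Real.cos (p.2 + Real.pi / 3))) :=
    (measurable_fst.ennreal_ofReal.mul (hf.comp measurable_fst)).mul
      (measurable_obliqueDensity.comp (f := fun p : ℝ × ℝ =>
        (2 / √3 * p.1 * Real.cos p.2, 2 / √3 * p.1 * Real.cos (p.2 + Real.pi / 3)))
        (by fun_prop)).ennreal_ofReal
  have hang : ∀ ρ : ℝ, ∫⁻ θ in Set.Ioo (-Real.pi) Real.pi, ENNReal.ofReal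
      (obliqueDensity (ρ * Real.cos θ) (ρ * Real.cos (θ + Real.pi / 3))) =
      ENNReal.ofReal (angularIntegral ρ) := by
    intro ρ
    have hc := continuous_obliqueDensity_circle ρ
    rw [angularIntegral, intervalIntegral.integral_of_le (by linarith [Real.pi_pos]),
      ← restrict_Ioo_eq_restrict_Ioc, ofReal_integral_eq_lintegral_ofReal
        ((hc.integrableOn_Icc (a := -Real.pi) (b := Real.pi)).mono_set Set.Ioo_subset_Icc_self)
        (Filter.Eventually.of_forall fun θ => obliqueDensity_nonneg _ _)]
  have hsplit : ∫⁻ r, ENNReal.ofReal (heDensity r) * f r =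
      ∫⁻ r in Set.Ioi 0, ENNReal.ofReal (heDensity r) * f r := by
    rw [← lintegral_indicator measurableSet_Ioi]
    refine lintegral_congr fun r => ?_
    by_cases hr : 0 < r
    · rw [Set.indicator_of_mem (Set.mem_Ioi.mpr hr)]
    · rw [Set.indicator_of_notMem (s := Set.Ioi 0) hr, heDensity_of_nonpos (not_lt.mp hr),
        ENNReal.ofReal_zero, zero_mul]
  have hae : ∀ᵐ p ∂((volume.restrict (Set.Ioi (0 : ℝ))).prod
      (volume.restrict (Set.Ioo (-Real.pi) Real.pi))), 0 < p.1 := by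
    rw [Measure.prod_restrict]
    filter_upwards [ae_restrict_mem (measurableSet_Ioi.prod measurableSet_Ioo)] with p hp
    exact hp.1
  rw [lintegral_congr_ae (hae.mono hcongr), lintegral_prod _ hm.aemeasurable, hsplit,
    ← lintegral_const_mul' _ _ ENNReal.ofReal_ne_top]
  refine setLIntegral_congr_fun measurableSet_Ioi fun r hr => ?_
  have hr' : 0 < r := hr
  dsimp only
  rw [lintegral_const_mul _ ((continuous_obliqueDensity_circle _).measurable.ennreal_ofReal), hang,
    heDensity_eq hr', ENNReal.ofReal_mul (by positivity), ENNReal.ofReal_mul (by positivity)]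
  ring

theorem map_dist_unit_squares :
    ((unitUniform.prod unitUniform).prod (unitUniform.prod unitUniform)).map
      (fun w : (ℝ × ℝ) × (ℝ × ℝ) =>
        dist ((0 : Plane) + w.1.1 • hexVertex 2 + w.1.2 • hexVertex 4)
          (rightCentre + w.2.1 • hexVertex 4 + w.2.2 • hexVertex 6)) =
      (volume : Measure ℝ).withDensity fun d => ENNReal.ofReal (heDensity d) := by
  have hdens : Measurable fun d => ENNReal.ofReal (heDensity d) := by
    refine Measurable.ennreal_ofReal ?_
    unfold heDensity hePiece1 hePiece2 hePiece3 hePiece4 hePiece5 hePiece6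
    refine Measurable.ite measurableSet_Iio measurable_const ?_
    iterate 6 refine Measurable.ite measurableSet_Iic (by fun_prop) ?_
    exact measurable_const
  refine Measure.ext_of_lintegral _ fun f hf => ?_
  simp_rw [dist_rhombi]
  have hm : Measurable fun w : (ℝ × ℝ) × (ℝ × ℝ) =>
      √((w.2.2 + (2 + w.1.1)) ^ 2 - (w.2.2 + (2 + w.1.1)) * (w.2.1 + (1 + w.1.1 - w.1.2)) +
        (w.2.1 + (1 + w.1.1 - w.1.2)) ^ 2) := by fun_prop
  have hF : Measurable fun z : ℝ × ℝ => f √(z.2 ^ 2 - z.2 * z.1 + z.1 ^ 2) :=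
    hf.comp (by fun_prop)
  rw [lintegral_map hf hm, lintegral_withDensity_eq_lintegral_mul _ hdens hf]
  exact (lintegral_prod _ (hf.comp hm).aemeasurable).trans ((lintegral_unit_squares hF).trans
    ((lintegral_oblique hf).trans (lintegral_polar hf)))

theorem mainTheorem8 {Ω : Type*} [MeasurableSpace Ω] (P : Measure Ω) [IsProbabilityMeasure P]
    (φ : Plane ≃ᵃⁱ[ℝ] Plane) (X Y : Ω → Plane)
    (hX : pdf.IsUniform X (φ '' rhombusH) P volume)
    (hY : pdf.IsUniform Y (φ '' rhombusE) P volume)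
    (hXY : IndepFun X Y P) :
    -- the six formulas agree at the common endpoints of their intervals
    (hePiece1 2 = hePiece2 2 ∧
      hePiece2 (3 * √3 / 2) = hePiece3 (3 * √3 / 2) ∧
      hePiece3 (√7) = hePiece4 (√7) ∧
      hePiece4 3 = hePiece5 3 ∧
      hePiece5 (2 * √3) = hePiece6 (2 * √3)) ∧
    -- `heDensity` is non-negative and is the density of the distance
    (∀ d : ℝ, 0 ≤ heDensity d) ∧
    P.map (fun ω => dist (X ω) (Y ω)) =
      (volume : Measure ℝ).withDensity (fun d => ENNReal.ofReal (heDensity d)) := by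
  refine ⟨hePieces_agree, heDensity_nonneg, ?_⟩
  have hφ : Measurable φ := φ.continuous.measurable
  have hmH : Measurable fun p : ℝ × ℝ => (0 : Plane) + p.1 • hexVertex 2 + p.2 • hexVertex 4 := by
    fun_prop
  have hmE : Measurable fun p : ℝ × ℝ =>
      rightCentre + p.1 • hexVertex 4 + p.2 • hexVertex 6 := by
    fun_prop
  have hφH : Measurable fun p : ℝ × ℝ =>
      φ ((0 : Plane) + p.1 • hexVertex 2 + p.2 • hexVertex 4) := hφ.comp hmH
  have hφE : Measurable fun p : ℝ × ℝ =>
      φ (rightCentre + p.1 • hexVertex 4 + p.2 • hexVertex 6) := hφ.comp hmE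
  have mX : P.map X = (unitUniform.prod unitUniform).map fun p =>
      φ (0 + p.1 • hexVertex 2 + p.2 • hexVertex 4) := by
    rw [show P.map X = cond volume (φ '' rhombusH) from hX, cond_isometry_image, cond_rhombusH,
      Measure.map_map hφ hmH]
    rfl
  have mY : P.map Y = (unitUniform.prod unitUniform).map fun p =>
      φ (rightCentre + p.1 • hexVertex 4 + p.2 • hexVertex 6) := by
    rw [show P.map Y = cond volume (φ '' rhombusE) from hY, cond_isometry_image, cond_rhombusE,
      Measure.map_map hφ hmE]
    rfl
  -- The pushforward under a map that is not a.e. measurable is 0 by convention, which is not a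
  -- probability measure; uniformity therefore forces measurability.
  have aX : AEMeasurable X P := by
    by_contra h
    have := mX
    rw [Measure.map_of_not_aemeasurable h] at this
    have hp := Measure.isProbabilityMeasure_map (μ := unitUniform.prod unitUniform)
      hφH.aemeasurable
    exact hp.ne_zero _ this.symm
  have aY : AEMeasurable Y P := by
    by_contra h
    have := mY
    rw [Measure.map_of_not_aemeasurable h] at this
    have hp := Measure.isProbabilityMeasure_map (μ := unitUniform.prod unitUniform)
      hφE.aemeasurable
    exact hp.ne_zero _ this.symm
  have hjoint := (indepFun_iff_map_prod_eq_prod_map_map aX aY).mp hXY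
  rw [mX, mY, Measure.map_prod_map _ _ hφH hφE] at hjoint
  have hdist : Measurable fun z : Plane × Plane => dist z.1 z.2 := continuous_dist.measurable
  have e : P.map (fun ω => dist (X ω) (Y ω)) =
      (P.map fun ω => (X ω, Y ω)).map fun z => dist z.1 z.2 :=
    (AEMeasurable.map_map_of_aemeasurable hdist.aemeasurable (aX.prodMk aY)).symm
  rw [e, hjoint, Measure.map_map hdist (hφH.prodMap hφE),
    ← map_dist_unit_squares]
  congr 1
  funext w
  -- This is the only place where φ meets the distance: it drops out as an isometry.
  exact φ.dist_map _ _
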